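/- For complex numbers $a,q$ and $m\ge 0$ put $(a;q)_m=\prod_{j=0}^{m-1}(1-aq^j)$ and, for $|q|<1$, $(a;q)_\infty=\prod_{j\ge 0}(1-aq^j)$, $(a_1,a_2,a_3;q)_\infty=(a_1;q)_\infty(a_2;q)_\infty(a_3;q)_\infty$. Then for every complex $q$ with $|q|<1$ (and $q\neq 0$ in the fourth identity, where $q^{-2}$ occurs) the following seven double series converge absolutely and the identities hold: \begin{gather*} \sum_{n,r\ge 0}\frac{q^{4n^2+8nr+6r^2+4n+6r}}{(-q^2;q^2)_{2n+2r+1}(q^2;q^2)_r(-q;q)_{2r+1}(q^4;q^4)_n}=\frac{(q,q^{14},q^{15};q^{15})_\infty}{(q^4;q^4)_\infty},\\ \sum_{n,r\ge 0}\frac{q^{4n^2+8nr+6r^2+4n+6r}}{(-q^2;q^2)_{2n+2r+1}(q^2;q^2)_r(-q;q)_{2r}(q^4;q^4)_n}=\frac{(q^2,q^{13},q^{15};q^{15})_\infty}{(q^4;q^4)_\infty},\\ \sum_{n,r\ge 0}\frac{q^{4n^2+8nr+6r^2+4n+6r}\,(1+q^{2r+1}+2q^{2r+2}+q^{4r+3}+q^{4n+4r+4})}{(-q^2;q^2)_{2n+2r+1}(q^2;q^2)_r(-q;q)_{2r+2}(q^4;q^4)_n}=\frac{(q^3,q^{12},q^{15};q^{15})_\infty}{(q^4;q^4)_\infty},\\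 \sum_{n,r\ge 0}\frac{q^{4n^2+8nr+6r^2-2}\,(q^{4r}+q^{4r+2}+q^{6r+1}+q^{4n+6r+3}-1-q^{2r+1})}{(-q^2;q^2)_{2n+2r}(q^2;q^2)_r(-q;q)_{2r+1}(q^4;q^4)_n}=\frac{(q^4,q^{11},q^{15};q^{15})_\infty}{(q^4;q^4)_\infty},\\ \sum_{n,r\ge 0}\frac{q^{4n^2+8nr+6r^2+2r}\,(1+q^{4n+2r+1})}{(-q^2;q^2)_{2n+2r}(q^2;q^2)_r(-q;q)_{2r+1}(q^4;q^4)_n}=\frac{(q^5;q^5)_\infty}{(q^4;q^4)_\infty},\\ \sum_{n,r\ge 0}\frac{q^{4n^2+8nr+6r^2+2r}}{(-q^2;q^2)_{2n+2r}(q^2;q^2)_r(-q;q)_{2r}(q^4;q^4)_n}=\frac{(q^6,q^9,q^{15};q^{15})_\infty}{(q^4;q^4)_\infty},\\ \sum_{n,r\ge 0}\frac{q^{4n^2+8nr+6r^2}}{(-q^2;q^2)_{2n+2r}(q^2;q^2)_r(-q;q)_{2r}(q^4;q^4)_n}=\frac{(q^7,q^8,q^{15};q^{15})_\infty}{(q^4;q^4)_\infty}.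 \end{gather*} -/

import Mathlib

/-- The finite `q`-shifted factorial `(a;q)_m = ∏_{0 ≤ j < m} (1 - a q^j)`. -/
def qPoch (a q : ℂ) (m : ℕ) : ℂ := ∏ j ∈ Finset.range m, (1 - a * q ^ j)

/-- The infinite `q`-shifted factorial `(a;q)_∞ = ∏_{j ≥ 0} (1 - a q^j)`
(a convergent product whenever `‖q‖ < 1`, see `multipliable_qPochInf`). -/
noncomputable def qPochInf (a q : ℂ) : ℂ := ∏' j : ℕ, (1 - a * q ^ j)

/-- `(a₁, a₂, a₃; q)_∞ = (a₁;q)_∞ (a₂;q)_∞ (a₃;q)_∞`. -/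
noncomputable def qPochInf₃ (a₁ a₂ a₃ q : ℂ) : ℂ :=
  qPochInf a₁ q * qPochInf a₂ q * qPochInf a₃ q

/-- The infinite product defining `(a;q)_∞` converges for `‖q‖ < 1`. -/
theorem multipliable_qPochInf (a : ℂ) {q : ℂ} (hq : ‖q‖ < 1) :
    Multipliable fun j : ℕ => 1 - a * q ^ j := by
  have hs : Summable fun j : ℕ => ‖-(a * q ^ j)‖ := by
    simp only [norm_neg, norm_mul, norm_pow]
    exact (summable_geometric_of_lt_one (norm_nonneg q) hq).mul_left _
  simpa [sub_eq_add_neg] using multipliable_one_add_of_summable hs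

open Filter Topology

/-! ### Finite and infinite `q`-shifted factorials -/

/-! Write q = x² and Q = x⁴ = q². The engine is Bailey's transform with the kernel K_d(n,j) =
1/((Q;Q)_{n-j} (Q;Q)_{n+j+d}), where 1/(Q;Q)_k is 0 for k < 0, so that every sum can run over ℤ.
Take a_j = (-1)^j x^{3j²+cj} and β_r = Σ_j a_j K_d(r,j). For small odd c the reflections j ↦ -j and
j ↦ -1-j force first-order recurrences that give β in closed form: 1/((q²;q²)_r (-q;q)_{2r}) for
(d,c) = (0,1) and 1/((q²;q²)_r (-q;q)_{2r+1}) for (1,1) (`thetaBailey_zero_one`,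
`thetaBailey_one_one`).

Summation against Q^{r²+dr}/(Q²;Q²)_{N-r} moves the kernel to base Q², multiplies a_j by Q^{j²+dj}
and produces (-Q;Q)_{2N+d} (`hasSum_change_of_base`). Summation against Q^{2(N²+dN)} then removes
the kernel and leaves Q^{2(j²+dj)}/(Q²;Q²)_∞ (`hasSum_bailey`, which is Cauchy's identity). The
coefficients of j² add up to 3+4+8 = 15, so with N = n+r the double series equals
θ(c+12d)/(q⁴;q⁴)_∞, where θ(c) = Σ (-1)^j x^{15j²+cj}. By Jacobi's triple product θ(b-a) =
(q^a,q^b,q^15;q^15)_∞ when a+b = 15.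

The seven products are θ(13), θ(11), ..., θ(1). The values 13, 11, 3, 1 come out directly. For 9, 7,
5 a linear exponent or the index of a denominator is shifted, which gives a combination of thetas;
it collapses because θ(15) = 0 and θ(c) = -x^{15-c} θ(30-c), and for 9 by subtracting the series for
7. The third and fourth summands arise from the resulting series by adding a difference that
telescopes in r. -/

theorem qPoch_succ (a q : ℂ) (m : ℕ) : qPoch a q (m + 1) = qPoch a q m * (1 - a * q ^ m) :=
  Finset.prod_range_succ _ _

@[simp] theorem qPoch_zero (a q : ℂ) : qPoch a q 0 = 1 := rfl

theorem one_sub_ne_zero_of_norm_lt_one {z : ℂ} (hz : ‖z‖ < 1) : 1 - z ≠ 0 := by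
  intro h
  rw [← sub_eq_zero.mp h] at hz
  simp at hz

theorem norm_mul_pow_lt_one {a q : ℂ} (ha : ‖a‖ < 1) (hq : ‖q‖ < 1) (j : ℕ) :
    ‖a * q ^ j‖ < 1 := by
  rw [norm_mul, norm_pow]
  exact mul_lt_one_of_nonneg_of_lt_one_left (norm_nonneg _) ha
    (pow_le_one₀ (norm_nonneg _) hq.le)

theorem qPoch_ne_zero {a q : ℂ} (ha : ‖a‖ < 1) (hq : ‖q‖ < 1) (m : ℕ) : qPoch a q m ≠ 0 :=
  Finset.prod_ne_zero_iff.mpr fun j _ =>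
    one_sub_ne_zero_of_norm_lt_one (norm_mul_pow_lt_one ha hq j)

theorem tendsto_qPoch (a : ℂ) {q : ℂ} (hq : ‖q‖ < 1) :
    Tendsto (qPoch a q) atTop (𝓝 (qPochInf a q)) :=
  (multipliable_qPochInf a hq).hasProd.tendsto_prod_nat

theorem qPochInf_ne_zero {a q : ℂ} (ha : ‖a‖ < 1) (hq : ‖q‖ < 1) : qPochInf a q ≠ 0 := by
  have hs : Summable fun j : ℕ => ‖-(a * q ^ j)‖ := by
    simp only [norm_neg, norm_mul, norm_pow]
    exact (summable_geometric_of_lt_one (norm_nonneg q) hq).mul_left _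
  have := tprod_one_add_ne_zero_of_summable (f := fun j : ℕ => -(a * q ^ j))
    (fun j => by
      rw [← sub_eq_add_neg]
      exact one_sub_ne_zero_of_norm_lt_one (norm_mul_pow_lt_one ha hq j)) hs
  simpa only [qPochInf, sub_eq_add_neg] using this

/-- The reciprocal of `(a;q)_k` for an integer `k ≥ 0`; the value at `k < 0` is `1`. -/
noncomputable def qPochInv (a q : ℂ) (k : ℤ) : ℂ := (qPoch a q k.toNat)⁻¹

/-- The reciprocal of `(q;q)_k`, which vanishes for negative `k`. -/
noncomputable def recipQPoch (q : ℂ) (k : ℤ) : ℂ := if k < 0 then 0 else qPochInv q q k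

theorem qPochInv_natCast (a q : ℂ) (k : ℕ) : qPochInv a q k = (qPoch a q k)⁻¹ := rfl

theorem recipQPoch_natCast (q : ℂ) (k : ℕ) : recipQPoch q k = (qPoch q q k)⁻¹ := by
  simp [recipQPoch, qPochInv_natCast]

theorem recipQPoch_of_neg (q : ℂ) {k : ℤ} (hk : k < 0) : recipQPoch q k = 0 := if_pos hk

@[simp] theorem recipQPoch_zero (q : ℂ) : recipQPoch q 0 = 1 := by
  simpa using recipQPoch_natCast q 0

theorem qPochInv_eq_mul_succ {a q : ℂ} (ha : ‖a‖ < 1) (hq : ‖q‖ < 1) {k : ℤ} (hk : 0 ≤ k) :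
    qPochInv a q k = (1 - a * q ^ k) * qPochInv a q (k + 1) := by
  lift k to ℕ using hk
  rw [show (k : ℤ) + 1 = ((k + 1 : ℕ) : ℤ) by simp, qPochInv_natCast, qPochInv_natCast, qPoch_succ,
    zpow_natCast]
  have h1 := qPoch_ne_zero ha hq k
  have h2 := one_sub_ne_zero_of_norm_lt_one (norm_mul_pow_lt_one ha hq k)
  field_simp

/-- The factor 1 - q^k vanishes at k = 0, in agreement with the value 0 at negative indices. The
recurrence therefore holds on all of ℤ and the later sums have no boundary terms. -/
theorem recipQPoch_sub_one {q : ℂ} (hq : ‖q‖ < 1) (k : ℤ) :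
    recipQPoch q (k - 1) = (1 - q ^ k) * recipQPoch q k := by
  rcases lt_trichotomy k 0 with hk | rfl | hk
  · rw [recipQPoch_of_neg _ hk, recipQPoch_of_neg _ (by lia), mul_zero]
  · rw [recipQPoch_of_neg _ (by lia)]; simp
  · by_cases h0 : q = 0
    · obtain ⟨m, rfl⟩ : ∃ m : ℕ, k = m + 1 := ⟨(k - 1).toNat, by lia⟩
      subst h0
      have : ∀ i : ℕ, recipQPoch 0 i = 1 := fun i => by simp [recipQPoch_natCast, qPoch]
      rw [show (m : ℤ) + 1 - 1 = (m : ℕ) by simp, show (m : ℤ) + 1 = (m + 1 : ℕ) by simp, this,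
        this, zpow_natCast]
      simp
    · have := qPochInv_eq_mul_succ hq hq (k := k - 1) (by lia)
      rw [recipQPoch, if_neg (by lia), recipQPoch, if_neg (by lia), this, ← zpow_one_add₀ h0]
      simp

theorem recipQPoch_eq_mul_succ {q : ℂ} (hq : ‖q‖ < 1) (k : ℤ) :
    recipQPoch q k = (1 - q ^ (k + 1)) * recipQPoch q (k + 1) := by
  simpa using recipQPoch_sub_one hq (k + 1)

theorem tendsto_qPochInv {a q : ℂ} (ha : ‖a‖ < 1) (hq : ‖q‖ < 1) :
    Tendsto (qPochInv a q) atTop (𝓝 (qPochInf a q)⁻¹) := by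
  have h : Tendsto (fun k : ℤ => k.toNat) atTop atTop :=
    tendsto_atTop.mpr fun b => (eventually_ge_atTop (b : ℤ)).mono fun k hk => by lia
  exact ((tendsto_qPoch a hq).comp h).inv₀ (qPochInf_ne_zero ha hq)

theorem tendsto_recipQPoch {q : ℂ} (hq : ‖q‖ < 1) :
    Tendsto (recipQPoch q) atTop (𝓝 (qPochInf q q)⁻¹) := by
  refine (tendsto_qPochInv hq hq).congr' ?_
  filter_upwards [eventually_ge_atTop (0 : ℤ)] with k hk
  rw [recipQPoch, if_neg (by lia)]

theorem exists_norm_qPochInv_le {a q : ℂ} (ha : ‖a‖ < 1) (hq : ‖q‖ < 1) :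
    ∃ C, 0 ≤ C ∧ ∀ k, ‖qPochInv a q k‖ ≤ C := by
  have h := ((tendsto_qPoch a hq).inv₀ (qPochInf_ne_zero ha hq)).norm.bddAbove_range
  obtain ⟨C, hC⟩ := h
  have hC' : ∀ m : ℕ, ‖(qPoch a q m)⁻¹‖ ≤ C := fun m => hC ⟨m, rfl⟩
  exact ⟨C, (norm_nonneg _).trans (hC' 0), fun k => hC' _⟩

theorem exists_norm_recipQPoch_le {q : ℂ} (hq : ‖q‖ < 1) :
    ∃ C, 0 ≤ C ∧ ∀ k, ‖recipQPoch q k‖ ≤ C := by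
  obtain ⟨C, h0, hC⟩ := exists_norm_qPochInv_le hq hq
  refine ⟨C, h0, fun k => ?_⟩
  rw [recipQPoch]
  split_ifs
  · simpa using h0
  · exact hC k

/-! ### Summability -/

/-- The kernel `1 / ((q;q)_{n-j} (q;q)_{n+j+d})` of Bailey's transform. -/
noncomputable def baileyKernel (q : ℂ) (d n j : ℤ) : ℂ :=
  recipQPoch q (n - j) * recipQPoch q (n + j + d)

theorem baileyKernel_eq_zero (q : ℂ) {d n j : ℤ} (h : n < j ∨ n + j + d < 0) :
    baileyKernel q d n j = 0 := by
  rcases h with h | h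
  · rw [baileyKernel, recipQPoch_of_neg _ (by lia), zero_mul]
  · rw [baileyKernel, recipQPoch_of_neg _ h, mul_zero]

theorem baileyKernel_neg (q : ℂ) (d n j : ℤ) :
    baileyKernel q d n (-d - j) = baileyKernel q d n j := by
  rw [baileyKernel, baileyKernel, mul_comm]
  congr 2 <;> ring

theorem exists_norm_baileyKernel_le {q : ℂ} (hq : ‖q‖ < 1) :
    ∃ C, 0 ≤ C ∧ ∀ d n j, ‖baileyKernel q d n j‖ ≤ C := by
  obtain ⟨C, h0, hC⟩ := exists_norm_recipQPoch_le hq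
  refine ⟨C * C, mul_nonneg h0 h0, fun d n j => ?_⟩
  rw [baileyKernel, norm_mul]
  exact mul_le_mul (hC _) (hC _) (norm_nonneg _) h0

theorem summable_mul_baileyKernel (q : ℂ) (g : ℤ → ℂ) (d n : ℤ) :
    Summable fun j => g j * baileyKernel q d n j := by
  refine summable_of_hasFiniteSupport ((Set.finite_Icc (-n - d) n).subset fun j hj => ?_)
  by_contra h
  simp only [Set.mem_Icc, not_and_or, not_le] at h
  exact hj (by simp [baileyKernel_eq_zero q (d := d) (n := n) (j := j) (by lia)])

theorem summable_zpow_quadratic {x : ℂ} (hx0 : x ≠ 0) (hx : ‖x‖ < 1) {A : ℤ} (hA : 0 < A)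
    (c : ℤ) : Summable fun j : ℤ => x ^ (A * j ^ 2 + c * j) := by
  have key : ∀ c : ℤ, Summable fun n : ℕ => x ^ (A * (n : ℤ) ^ 2 + c * n) := fun c => by
    -- With t = |c| + 1, the inequality n² - tn + t² ≥ 0 gives A n² + c n ≥ n - t², so a geometric
    -- series dominates.
    have hg : Summable fun n : ℕ => ‖x‖ ^ (-(|c| + 1) ^ 2) * ‖x‖ ^ n :=
      (summable_geometric_of_lt_one (norm_nonneg _) hx).mul_left _
    refine Summable.of_norm_bounded hg fun n => ?_
    rw [norm_zpow, ← zpow_natCast, ← zpow_add₀ (norm_ne_zero_iff.mpr hx0)]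
    refine zpow_le_zpow_right_of_le_one₀ (norm_pos_iff.mpr hx0) hx.le ?_
    have h1 : -|c| ≤ c := neg_abs_le c
    have h2 : (0 : ℤ) ≤ n := Int.natCast_nonneg n
    nlinarith [sq_nonneg ((n : ℤ) - (|c| + 1)), mul_le_mul_of_nonneg_right h1 h2, abs_nonneg c,
      mul_nonneg h2 (abs_nonneg c), mul_le_mul_of_nonneg_right (show (1 : ℤ) ≤ A by lia)
        (sq_nonneg (n : ℤ))]
  refine Summable.of_nat_of_neg (key c) ((key (-c)).congr fun n => ?_)
  congr 1; ring

theorem summable_prod_mul_bounded {ι κ : Type*} {f : ι → ℂ} {g : κ → ℂ} {h : ι × κ → ℂ} {C : ℝ}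
    (hf : Summable f) (hg : Summable g) (hh : ∀ z, ‖h z‖ ≤ C) :
    Summable fun z : ι × κ => f z.1 * g z.2 * h z := by
  refine Summable.of_norm_bounded
    ((hf.norm.mul_of_nonneg hg.norm (fun _ => norm_nonneg _) (fun _ => norm_nonneg _)).mul_right C)
    fun z => ?_
  rw [norm_mul, norm_mul]
  exact mul_le_mul_of_nonneg_left (hh z) (by positivity)

theorem tsum_int_add {f : ℤ → ℂ} (a : ℤ) : ∑' j, f (j + a) = ∑' j, f j :=
  (Equiv.addRight a).tsum_eq f

theorem tsum_int_sub_left {f : ℤ → ℂ} (a : ℤ) : ∑' j, f (a - j) = ∑' j, f j :=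
  (Equiv.subLeft a).tsum_eq f

/-! ### Jacobi's triple product -/

theorem HasSum.of_eq {ι : Type*} {f g : ι → ℂ} {s t : ℂ} (h : HasSum f s)
    (hf : ∀ i, g i = f i) (hs : t = s) : HasSum g t :=
  hs ▸ h.congr_fun hf

theorem HasSum.int_add {f : ℤ → ℂ} {s : ℂ} (h : HasSum f s) (a : ℤ) :
    HasSum (fun j => f (j + a)) s :=
  (Equiv.addRight a).hasSum_iff.mpr h

theorem HasSum.int_sub_left {f : ℤ → ℂ} {s : ℂ} (h : HasSum f s) (a : ℤ) :
    HasSum (fun j => f (a - j)) s :=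
  (Equiv.subLeft a).hasSum_iff.mpr h

theorem hasSum_mul_baileyKernel (q : ℂ) (g : ℤ → ℂ) (d n : ℤ) :
    HasSum (fun j => g j * baileyKernel q d n j) (∑' j, g j * baileyKernel q d n j) :=
  (summable_mul_baileyKernel q g d n).hasSum

/-- This is 1 - q^{a+b} = (1 - q^a) + q^a (1 - q^b) with a = n+j+1 and b = n-j. The companion below
uses b = n+1-j with the roles exchanged. -/
theorem one_sub_zpow_mul_baileyKernel_one {q : ℂ} (hq0 : q ≠ 0) (hq : ‖q‖ < 1) (n j : ℤ) :
    (1 - q ^ (2 * n + 1)) * baileyKernel q 1 n j =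
      baileyKernel q 0 n j + q ^ (n + j + 1) * baileyKernel q 0 n (j + 1) := by
  have h1 := recipQPoch_sub_one hq (n + j + 1)
  have h2 := recipQPoch_sub_one hq (n - j)
  rw [baileyKernel, baileyKernel, baileyKernel, add_zero, add_zero,
    show n - (j + 1) = n - j - 1 by ring, h2, show n + (j + 1) = n + j + 1 by ring,
    show n + j = n + j + 1 - 1 by ring, h1, show n + j + 1 - 1 + 1 = n + j + 1 by ring]
  have h3 : q ^ (2 * n + 1) = q ^ (n + j + 1) * q ^ (n - j) := by
    rw [← zpow_add₀ hq0]; congr 1; ring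
  rw [h3]; ring

theorem one_sub_zpow_mul_baileyKernel_zero {q : ℂ} (hq0 : q ≠ 0) (hq : ‖q‖ < 1) (n j : ℤ) :
    (1 - q ^ (2 * n + 2)) * baileyKernel q 0 (n + 1) j =
      baileyKernel q 1 n j + q ^ (n + 1 - j) * baileyKernel q 1 n (j - 1) := by
  have h1 := recipQPoch_sub_one hq (n + j + 1)
  have h2 := recipQPoch_sub_one hq (n + 1 - j)
  rw [baileyKernel, baileyKernel, baileyKernel, add_zero,
    show n - (j - 1) = n + 1 - j by ring, show n - j = n + 1 - j - 1 by ring, h2,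
    show n + 1 + j = n + j + 1 by ring,
    show n + (j - 1) + 1 = n + j + 1 - 1 by ring, h1]
  have h3 : q ^ (2 * n + 2) = q ^ (n + j + 1) * q ^ (n + 1 - j) := by
    rw [← zpow_add₀ hq0]; congr 1; ring
  rw [h3]; ring

/-- The finite form of Jacobi's triple product. -/
theorem tsum_mul_baileyKernel_zero_eq {q z : ℂ} (hq0 : q ≠ 0) (hq : ‖q‖ < 1) (hz : z ≠ 0)
    {w : ℤ → ℂ} (hw0 : w 0 = 1) (hw : ∀ j, w (j + 1) = -(z * q ^ j) * w j) (n : ℕ) :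
    ∑' j, w j * baileyKernel q 0 n j =
      qPoch z q n * qPoch (q / z) q n * recipQPoch q (2 * n) := by
  induction n with
  | zero =>
    rw [tsum_eq_single 0]
    · simp [baileyKernel, hw0]
    · intro j hj
      rw [baileyKernel_eq_zero _ (by push_cast; lia), mul_zero]
  | succ n ih =>
    have hS := hasSum_mul_baileyKernel q w 0 n
    have hT := hasSum_mul_baileyKernel q w 1 n
    have hS' := hasSum_mul_baileyKernel q w 0 (n + 1)
    -- The step from n to n+1 passes through the kernel with d = 1. The recursion of `w` absorbs the
    -- shifts in j, so the two half-steps contribute the factors 1 - (q/z)q^n and 1 - zq^n.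
    have e1 := (hT.mul_left (1 - q ^ (2 * (n : ℤ) + 1))).unique
      ((hS.sub ((hS.int_add 1).mul_left (q ^ ((n : ℤ) + 1) / z))).congr_fun fun j => by
        have h := one_sub_zpow_mul_baileyKernel_one hq0 hq n j
        rw [hw, mul_left_comm, h, show (n : ℤ) + j + 1 = (n + 1) + j by ring, zpow_add₀ hq0 _ j]
        field_simp
        ring)
    have e2 := (hS'.mul_left (1 - q ^ (2 * (n : ℤ) + 2))).unique
      ((hT.sub ((hT.int_add (-1)).mul_left (z * q ^ (n : ℤ)))).congr_fun fun j => by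
        have h := one_sub_zpow_mul_baileyKernel_zero hq0 hq n j
        have h' := hw (j + -1)
        rw [neg_add_cancel_right] at h'
        rw [mul_left_comm, h, ← sub_eq_add_neg, show (n : ℤ) + 1 - j = n - (j - 1) by ring,
          zpow_sub₀ hq0 _ (j - 1), h', ← sub_eq_add_neg]
        have := zpow_ne_zero (j - 1) hq0
        field_simp
        ring)
    have h1 := recipQPoch_eq_mul_succ hq (2 * (n : ℤ))
    have h2 := recipQPoch_eq_mul_succ hq (2 * (n : ℤ) + 1)
    have n1 : (1 : ℂ) - q ^ (2 * (n : ℤ) + 1) ≠ 0 := by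
      rw [show 2 * (n : ℤ) + 1 = ((2 * n + 1 : ℕ) : ℤ) by simp, zpow_natCast, pow_succ']
      exact one_sub_ne_zero_of_norm_lt_one (norm_mul_pow_lt_one hq hq _)
    have n2 : (1 : ℂ) - q ^ (2 * (n : ℤ) + 2) ≠ 0 := by
      rw [show 2 * (n : ℤ) + 2 = ((2 * n + 1 + 1 : ℕ) : ℤ) by push_cast; ring, zpow_natCast,
        pow_succ']
      exact one_sub_ne_zero_of_norm_lt_one (norm_mul_pow_lt_one hq hq _)
    push_cast
    rw [qPoch_succ, qPoch_succ, show 2 * ((n : ℤ) + 1) = 2 * n + 1 + 1 by ring]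
    rw [show 2 * (n : ℤ) + 1 + 1 = 2 * n + 2 by ring] at h2 ⊢
    apply mul_left_cancel₀ n2
    apply mul_left_cancel₀ n1
    rw [e2]
    rw [h2] at h1
    rw [ih, h1] at e1
    rw [zpow_natCast] at *
    have e3 : q ^ ((n : ℤ) + 1) / z = q / z * q ^ n := by
      rw [zpow_add₀ hq0, zpow_natCast, zpow_one]; ring
    rw [e3] at e1
    linear_combination (1 - z * q ^ n) * e1

/-- Jacobi's triple product, for the weights `w j = (-z)^j q^(j(j-1)/2)`. -/
theorem jacobi_triple_product {q z : ℂ} (hq0 : q ≠ 0) (hq : ‖q‖ < 1) (hz : z ≠ 0)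
    {w : ℤ → ℂ} (hw0 : w 0 = 1) (hw : ∀ j, w (j + 1) = -(z * q ^ j) * w j) (hs : Summable w) :
    ∑' j, w j = qPochInf₃ z (q / z) q q := by
  obtain ⟨C, hC0, hC⟩ := exists_norm_baileyKernel_le hq
  have hP := qPochInf_ne_zero hq hq
  have hR := tendsto_recipQPoch hq
  have cast : Tendsto (fun n : ℕ => (n : ℤ)) atTop atTop := tendsto_natCast_atTop_atTop
  -- Each kernel value tends to 1/(q;q)_∞², and the uniform kernel bound supplies a summable
  -- majorant.
  have l1 : Tendsto (fun n : ℕ => ∑' j, w j * baileyKernel q 0 n j) atTop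
      (𝓝 (∑' j, w j * ((qPochInf q q)⁻¹ * (qPochInf q q)⁻¹))) := by
    refine tendsto_tsum_of_dominated_convergence (hs.norm.mul_right C) (fun j => ?_)
      (Eventually.of_forall fun n j => ?_)
    · refine Tendsto.const_mul _ (Tendsto.mul (hR.comp ?_) (hR.comp ?_))
      · simpa only [sub_eq_add_neg] using tendsto_atTop_add_const_right _ (-j) cast
      · simpa only [add_zero] using tendsto_atTop_add_const_right _ j cast
    · rw [norm_mul]
      exact mul_le_mul_of_nonneg_left (hC _ _ _) (norm_nonneg _)
  have l2 : Tendsto (fun n : ℕ => ∑' j, w j * baileyKernel q 0 n j) atTop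
      (𝓝 (qPochInf z q * qPochInf (q / z) q * (qPochInf q q)⁻¹)) := by
    simp only [tsum_mul_baileyKernel_zero_eq hq0 hq hz hw0 hw]
    refine ((tendsto_qPoch z hq).mul (tendsto_qPoch (q / z) hq)).mul (hR.comp ?_)
    exact tendsto_atTop_mono (fun n => by lia) cast
  have := tendsto_nhds_unique l1 l2
  rw [tsum_mul_right] at this
  field_simp at this
  rw [qPochInf₃, this]
  ring

/-! ### Bailey pairs -/

/-- The general term `(-1)^j x^(A j² + c j)` of a theta series. -/
noncomputable def thetaTerm (x : ℂ) (A c j : ℤ) : ℂ := (-1) ^ j * x ^ (A * j ^ 2 + c * j)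

theorem thetaTerm_add {x : ℂ} (hx : x ≠ 0) (A c d j : ℤ) :
    thetaTerm x A (c + d) j = thetaTerm x A c j * x ^ (d * j) := by
  rw [thetaTerm, thetaTerm, mul_assoc, ← zpow_add₀ hx]
  congr 2; ring

theorem thetaTerm_neg (x : ℂ) (A c j : ℤ) : thetaTerm x A c (-j) = thetaTerm x A (-c) j := by
  rw [thetaTerm, thetaTerm, zpow_neg, ← inv_zpow, inv_neg, inv_one]
  congr 2; ring

theorem thetaTerm_neg_one_sub {x : ℂ} (hx : x ≠ 0) (A c j : ℤ) :
    thetaTerm x A c (-1 - j) = -x ^ (A - c) * thetaTerm x A (2 * A - c) j := by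
  rw [thetaTerm, thetaTerm, zpow_sub₀ (by norm_num : (-1 : ℂ) ≠ 0), zpow_neg_one, div_eq_mul_inv,
    ← inv_zpow, inv_neg, inv_one, mul_left_comm, neg_mul (x ^ (A - c)), ← zpow_add₀ hx]
  have : A * (-1 - j) ^ 2 + c * (-1 - j) = A - c + (A * j ^ 2 + (2 * A - c) * j) := by ring
  rw [this]; ring

theorem summable_thetaTerm {x : ℂ} (hx0 : x ≠ 0) (hx : ‖x‖ < 1) {A : ℤ} (hA : 0 < A) (c : ℤ) :
    Summable (thetaTerm x A c) := by
  refine Summable.of_norm ((summable_zpow_quadratic hx0 hx hA c).norm.congr fun j => ?_)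
  simp [thetaTerm]

theorem pow_zpow_eq (x : ℂ) (k : ℕ) (m : ℤ) : (x ^ k) ^ m = x ^ ((k : ℤ) * m) := by
  rw [← zpow_natCast, ← zpow_mul]

theorem norm_pow_lt_one {x : ℂ} (hx : ‖x‖ < 1) {k : ℕ} (hk : k ≠ 0) : ‖x ^ k‖ < 1 := by
  rw [norm_pow]; exact pow_lt_one₀ (norm_nonneg _) hx hk

/-- The sequence obtained from `(-1)^j x^(3j² + cj)` by Bailey's transform to the base `x⁴`. -/
noncomputable def thetaBailey (x : ℂ) (d c n : ℤ) : ℂ :=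
  ∑' j, thetaTerm x 3 c j * baileyKernel (x ^ 4) d n j

theorem thetaBailey_of_neg (x : ℂ) {d c n : ℤ} (h : 2 * n + d < 0) : thetaBailey x d c n = 0 := by
  rw [thetaBailey, ← tsum_zero (β := ℤ)]
  congr 1; ext j
  rw [baileyKernel_eq_zero _ (by lia), mul_zero]

/-! ### Contiguous relations and reflections for the theta Bailey pairs -/

section
variable {x : ℂ} (hx0 : x ≠ 0) (hx : ‖x‖ < 1)
include hx0 hx

/-- Raising n-j to n+1-j in the kernel costs 1 - x^{4(n+1)} x^{-4j}, and x^{-4j} lowers c by 4. In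
`thetaBailey_zero_eq` the other factor is raised and c goes up by 4. -/
theorem thetaBailey_one_eq (c n : ℤ) : thetaBailey x 1 c n = thetaBailey x 0 c (n + 1) -
    x ^ (4 * n + 4) * thetaBailey x 0 (c - 4) (n + 1) := by
  refine (hasSum_mul_baileyKernel _ _ _ _).unique (((hasSum_mul_baileyKernel _ _ _ _).sub
    ((hasSum_mul_baileyKernel _ _ _ _).mul_left _)).congr_fun fun j => ?_)
  have h1 := recipQPoch_sub_one (norm_pow_lt_one hx four_ne_zero) (n + 1 - j)
  have h2 := thetaTerm_add hx0 3 c (-4) j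
  rw [← sub_eq_add_neg] at h2
  have h3 : x ^ (4 * n + 4) * x ^ (-4 * j) = (x ^ 4) ^ (n + 1 - j) := by
    rw [← zpow_add₀ hx0, ← zpow_natCast x 4, ← zpow_mul]; congr 1; push_cast; ring
  rw [h2, baileyKernel, baileyKernel, add_zero, show n - j = n + 1 - j - 1 by ring, h1,
    show n + j + 1 = n + 1 + j by ring, ← h3]
  ring

theorem thetaBailey_zero_eq (c n : ℤ) : thetaBailey x 0 c n = thetaBailey x 1 c n -
    x ^ (4 * n + 4) * thetaBailey x 1 (c + 4) n := by
  refine (hasSum_mul_baileyKernel _ _ _ _).unique (((hasSum_mul_baileyKernel _ _ _ _).sub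
    ((hasSum_mul_baileyKernel _ _ _ _).mul_left _)).congr_fun fun j => ?_)
  have h1 := recipQPoch_eq_mul_succ (norm_pow_lt_one hx four_ne_zero) (n + j)
  have h2 := thetaTerm_add hx0 3 c 4 j
  have h3 : x ^ (4 * n + 4) * x ^ (4 * j) = (x ^ 4) ^ (n + j + 1) := by
    rw [← zpow_add₀ hx0, ← zpow_natCast x 4, ← zpow_mul]; congr 1; push_cast; ring
  rw [h2, baileyKernel, baileyKernel, add_zero, h1, ← h3]
  ring

omit hx0 hx in
theorem thetaBailey_zero_neg (c n : ℤ) : thetaBailey x 0 (-c) n = thetaBailey x 0 c n := by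
  refine (hasSum_mul_baileyKernel _ _ _ _).unique
    (((hasSum_mul_baileyKernel _ _ _ _).int_sub_left 0).congr_fun fun j => ?_)
  have := baileyKernel_neg (x ^ 4) 0 n j
  rw [neg_zero] at this
  rw [this, zero_sub, thetaTerm_neg]

omit hx in
theorem thetaBailey_one_reflect (c n : ℤ) :
    thetaBailey x 1 c n = -x ^ (3 - c) * thetaBailey x 1 (6 - c) n := by
  refine ((hasSum_mul_baileyKernel _ _ _ _).int_sub_left (-1)).unique
    (((hasSum_mul_baileyKernel _ _ _ _).mul_left _).congr_fun fun j => ?_)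
  rw [baileyKernel_neg, thetaTerm_neg_one_sub hx0]
  ring_nf

omit hx in
-- c = 3 is the fixed point of c ↦ 6 - c, so the sum is its own negative.
theorem thetaBailey_one_three (n : ℤ) : thetaBailey x 1 3 n = 0 := by
  have := thetaBailey_one_reflect hx0 3 n
  norm_num at this
  linear_combination this / 2

theorem thetaBailey_zero_three (n : ℤ) :
    thetaBailey x 0 3 n = x ^ (4 * n) * thetaBailey x 0 1 n := by
  have h := thetaBailey_one_eq hx0 hx 3 (n - 1)
  rw [thetaBailey_one_three hx0, show (3 : ℤ) - 4 = -1 by norm_num, thetaBailey_zero_neg,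
    show 4 * (n - 1) + 4 = 4 * n by ring, sub_add_cancel] at h
  linear_combination -h

theorem thetaBailey_one_neg_one (n : ℤ) : thetaBailey x 1 (-1) n = thetaBailey x 0 1 n := by
  have h := thetaBailey_zero_eq hx0 hx (-1) n
  rw [show (-1 : ℤ) + 4 = 3 by norm_num, thetaBailey_one_three hx0, thetaBailey_zero_neg] at h
  linear_combination -h

/-- Together with `thetaBailey_zero_one_eq` this determines both sequences from one initial value.
`betaOdd_sub_one` and `betaEven_eq` are the same two relations for the product side. -/
theorem thetaBailey_one_one_sub_one (n : ℤ) :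
    thetaBailey x 1 1 (n - 1) = (1 - x ^ (8 * n)) * thetaBailey x 0 1 n := by
  have h := thetaBailey_one_eq hx0 hx 1 (n - 1)
  rw [show (1 : ℤ) - 4 = -3 by norm_num, thetaBailey_zero_neg, sub_add_cancel,
    thetaBailey_zero_three hx0 hx, ← mul_assoc, ← zpow_add₀ hx0] at h
  rw [h, show 4 * (n - 1) + 4 + 4 * n = 8 * n by ring]
  ring

theorem thetaBailey_zero_one_eq (n : ℤ) :
    thetaBailey x 0 1 n = (1 + x ^ (4 * n + 2)) * thetaBailey x 1 1 n := by
  have h := thetaBailey_zero_eq hx0 hx 1 n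
  have h' := thetaBailey_one_reflect hx0 1 n
  norm_num at h h'
  rw [h', h, h', show 4 * n + 4 = 4 * n + 2 + 2 by ring, zpow_add₀ hx0 (4 * n + 2),
    zpow_ofNat x 2]
  ring

end

/-- `1 / ((q²;q²)_r (-q;q)_{2r})`. -/
noncomputable def betaEven (q : ℂ) (r : ℤ) : ℂ :=
  recipQPoch (q ^ 2) r * qPochInv (-q) q (2 * r)

/-- `1 / ((q²;q²)_r (-q;q)_{2r+1})`. -/
noncomputable def betaOdd (q : ℂ) (r : ℤ) : ℂ :=
  recipQPoch (q ^ 2) r * qPochInv (-q) q (2 * r + 1)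

theorem betaEven_of_neg (q : ℂ) {r : ℤ} (h : r < 0) : betaEven q r = 0 := by
  rw [betaEven, recipQPoch_of_neg _ h, zero_mul]

theorem betaOdd_of_neg (q : ℂ) {r : ℤ} (h : r < 0) : betaOdd q r = 0 := by
  rw [betaOdd, recipQPoch_of_neg _ h, zero_mul]

theorem betaEven_eq {q : ℂ} (hq0 : q ≠ 0) (hq : ‖q‖ < 1) (r : ℤ) :
    betaEven q r = (1 + q ^ (2 * r + 1)) * betaOdd q r := by
  rcases lt_or_ge r 0 with h | h
  · rw [betaEven_of_neg q h, betaOdd_of_neg q h, mul_zero]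
  · rw [betaEven, betaOdd, qPochInv_eq_mul_succ (by rwa [norm_neg]) hq (by lia), neg_mul,
      ← zpow_one_add₀ hq0, add_comm 1 (2 * r)]
    ring

theorem betaOdd_sub_one {q : ℂ} (hq0 : q ≠ 0) (hq : ‖q‖ < 1) (r : ℤ) :
    betaOdd q (r - 1) = (1 - q ^ (4 * r)) * betaEven q r := by
  rcases lt_trichotomy r 0 with h | rfl | h
  · rw [betaEven_of_neg q h, betaOdd_of_neg q (by lia), mul_zero]
  · rw [betaOdd_of_neg q (by lia)]; simp
  · rw [betaEven, betaOdd, qPochInv_eq_mul_succ (by rwa [norm_neg]) hq (by lia),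
      recipQPoch_sub_one (norm_pow_lt_one hq two_ne_zero), neg_mul, ← zpow_one_add₀ hq0,
      show 1 + (2 * (r - 1) + 1) = 2 * r by ring, show 2 * (r - 1) + 1 + 1 = 2 * r by ring,
      ← zpow_natCast q 2, ← zpow_mul, show 4 * r = 2 * r + 2 * r by ring, zpow_add₀ hq0]
    push_cast
    ring

/-! ### Closed forms of the two Bailey pairs -/

section
variable {x : ℂ} (hx0 : x ≠ 0) (hx : ‖x‖ < 1)
include hx0 hx

theorem norm_zpow_lt_one {k : ℤ} (hk : 0 < k) : ‖x ^ k‖ < 1 := by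
  rw [norm_zpow]
  exact zpow_lt_one₀ (norm_pos_iff.mpr hx0) hx hk

theorem one_add_zpow_ne_zero {k : ℤ} (hk : 0 < k) : 1 + x ^ k ≠ 0 := by
  have h : ‖-x ^ k‖ < 1 := by
    rw [norm_neg]
    exact norm_zpow_lt_one hx0 hx hk
  simpa using one_sub_ne_zero_of_norm_lt_one h

theorem thetaBailey_zero_one (n : ℤ) : thetaBailey x 0 1 n = betaEven (x ^ 2) n := by
  rcases lt_or_ge n 0 with h | h
  · rw [thetaBailey_of_neg x (by lia), betaEven_of_neg _ h]
  lift n to ℕ using h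
  induction n with
  | zero =>
    rw [thetaBailey, tsum_eq_single 0]
    · simp [baileyKernel, thetaTerm, betaEven, qPochInv]
    · intro j hj
      rw [baileyKernel_eq_zero _ (by push_cast; lia), mul_zero]
  | succ n ih =>
    have h1 := thetaBailey_one_one_sub_one hx0 hx (n + 1)
    have h2 := thetaBailey_zero_one_eq hx0 hx n
    have hx2 : ‖x ^ 2‖ < 1 := norm_pow_lt_one hx two_ne_zero
    have h3 := betaOdd_sub_one (pow_ne_zero 2 hx0) hx2 (n + 1)
    have h4 := betaEven_eq (pow_ne_zero 2 hx0) hx2 n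
    rw [add_sub_cancel_right] at h1 h3
    rw [pow_zpow_eq] at h3 h4
    rw [show ((2 : ℕ) : ℤ) * (2 * (n : ℤ) + 1) = 4 * n + 2 by push_cast; ring] at h4
    rw [show ((2 : ℕ) : ℤ) * (4 * ((n : ℤ) + 1)) = 8 * (n + 1) by push_cast; ring] at h3
    have n1 := one_add_zpow_ne_zero hx0 hx (k := 4 * n + 2) (by lia)
    have n2 := one_sub_ne_zero_of_norm_lt_one
      (norm_zpow_lt_one hx0 hx (k := 8 * ((n : ℤ) + 1)) (by lia))
    push_cast
    apply mul_left_cancel₀ n2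
    apply mul_left_cancel₀ n1
    rw [← h1, ← h3, ← h2, ← h4, ih]

theorem thetaBailey_one_one (n : ℤ) : thetaBailey x 1 1 n = betaOdd (x ^ 2) n := by
  rcases lt_or_ge n 0 with h | h
  · rw [thetaBailey_of_neg x (by lia), betaOdd_of_neg _ h]
  have h1 := thetaBailey_zero_one_eq hx0 hx n
  have h2 := betaEven_eq (pow_ne_zero 2 hx0) (norm_pow_lt_one hx two_ne_zero) n
  rw [pow_zpow_eq, show ((2 : ℕ) : ℤ) * (2 * n + 1) = 4 * n + 2 by push_cast; ring] at h2
  apply mul_left_cancel₀ (one_add_zpow_ne_zero hx0 hx (k := 4 * n + 2) (by lia))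
  rw [← h1, ← h2, thetaBailey_zero_one hx0 hx]

end

/-! ### Change of base -/

/-- `(-Q;Q)_k` for an integer `k ≥ 0`; the value at `k < 0` is `1`. -/
noncomputable def qPochNeg (Q : ℂ) (k : ℤ) : ℂ := qPoch (-Q) Q k.toNat

theorem qPochNeg_succ {Q : ℂ} (hQ0 : Q ≠ 0) {k : ℤ} (hk : 0 ≤ k) :
    qPochNeg Q (k + 1) = qPochNeg Q k * (1 + Q ^ (k + 1)) := by
  rw [qPochNeg, qPochNeg, Int.toNat_add hk zero_le_one, show (1 : ℤ).toNat = 1 from rfl, qPoch_succ]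
  lift k to ℕ using hk
  rw [zpow_add_one₀ hQ0, Int.toNat_natCast, zpow_natCast]
  ring

theorem qPochInv_mul_qPochNeg {Q : ℂ} (hQ : ‖Q‖ < 1) (k : ℤ) :
    qPochInv (-Q) Q k * qPochNeg Q k = 1 :=
  inv_mul_cancel₀ (qPoch_ne_zero (by rwa [norm_neg]) hQ _)

theorem recipQPoch_eq_qPochNeg_mul (Q : ℂ) (hQ : ‖Q‖ < 1) (s : ℤ) :
    recipQPoch Q s = qPochNeg Q s * recipQPoch (Q ^ 2) s := by
  rcases lt_or_ge s 0 with h | h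
  · simp [recipQPoch_of_neg _ h]
  lift s to ℕ using h
  rw [recipQPoch_natCast, recipQPoch_natCast, qPochNeg, Int.toNat_natCast]
  have h1 := qPoch_ne_zero hQ hQ s
  have h2 := qPoch_ne_zero (norm_pow_lt_one hQ two_ne_zero) (norm_pow_lt_one hQ two_ne_zero) s
  field_simp
  rw [qPoch, qPoch, qPoch, ← Finset.prod_mul_distrib]
  refine Finset.prod_congr rfl fun j _ => ?_
  ring

/-- The summand of the change of base formula. -/
noncomputable def changeTerm (Q : ℂ) (s m j : ℤ) : ℂ :=
  Q ^ (j ^ 2 + s * j) *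
    (recipQPoch (Q ^ 2) (m - j) * recipQPoch Q j * recipQPoch Q (j + s))

theorem summable_changeTerm (Q : ℂ) (s m : ℤ) : Summable (changeTerm Q s m) := by
  refine summable_of_hasFiniteSupport ((Set.finite_Icc 0 m).subset fun j hj => ?_)
  by_contra h
  simp only [Set.mem_Icc, not_and_or, not_le] at h
  rcases h with h | h
  · exact hj (by simp [changeTerm, recipQPoch_of_neg Q h])
  · exact hj (by simp [changeTerm, recipQPoch_of_neg (Q ^ 2) (show m - j < 0 by lia)])

section
variable {Q : ℂ} (hQ0 : Q ≠ 0) (hQ : ‖Q‖ < 1)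
include hQ0 hQ

/-- Split 1 - Q^{2m} = (1 - Q^{2(m-j)}) + Q^{2(m-j)} (1 - Q^j)(1 + Q^j), then 1 + Q^j = (1 -
Q^{j+s}) + Q^j (1 + Q^s). Each binomial lowers the index of one factor. -/
theorem changeTerm_rec (s m j : ℤ) :
    (1 - Q ^ (2 * m)) * changeTerm Q s m j = changeTerm Q s (m - 1) j +
      Q ^ (2 * m + s - 1) * changeTerm Q s (m - 1) (j - 1) +
      Q ^ (2 * m + s) * (1 + Q ^ s) * changeTerm Q (s + 1) (m - 1) (j - 1) := by
  have h1 := recipQPoch_sub_one (norm_pow_lt_one hQ two_ne_zero) (m - j)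
  have h2 := recipQPoch_sub_one hQ j
  have h3 := recipQPoch_sub_one hQ (j + s)
  simp only [changeTerm]
  rw [show m - 1 - (j - 1) = m - j by ring, show j - 1 + s = j + s - 1 by ring,
    show j - 1 + (s + 1) = j + s by ring, show m - 1 - j = m - j - 1 by ring, h1, h2, h3,
    pow_zpow_eq]
  have e1 : Q ^ (((2 : ℕ) : ℤ) * (m - j)) = Q ^ (2 * m) * (Q ^ j)⁻¹ ^ 2 := by
    rw [← zpow_neg, ← zpow_natCast (Q ^ (-j)), ← zpow_mul, ← zpow_add₀ hQ0]
    congr 1; push_cast; ring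
  have e2 : Q ^ ((j - 1) ^ 2 + s * (j - 1)) =
      Q ^ (j ^ 2 + s * j) * (Q ^ j)⁻¹ ^ 2 * Q * (Q ^ s)⁻¹ := by
    rw [← zpow_neg, ← zpow_neg, ← zpow_natCast (Q ^ (-j)), ← zpow_mul, ← zpow_add₀ hQ0,
      ← zpow_add_one₀ hQ0, ← zpow_add₀ hQ0]
    congr 1; push_cast; ring
  have e3 : Q ^ ((j - 1) ^ 2 + (s + 1) * (j - 1)) =
      Q ^ (j ^ 2 + s * j) * (Q ^ j)⁻¹ * (Q ^ s)⁻¹ := by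
    rw [← zpow_neg, ← zpow_neg, ← zpow_add₀ hQ0, ← zpow_add₀ hQ0]
    congr 1; ring
  have e4 : Q ^ (j + s) = Q ^ j * Q ^ s := zpow_add₀ hQ0 _ _
  have e5 : Q ^ (2 * m + s - 1) = Q ^ (2 * m) * Q ^ s * Q⁻¹ := by
    rw [zpow_sub_one₀ hQ0, zpow_add₀ hQ0]
  have e6 : Q ^ (2 * m + s) = Q ^ (2 * m) * Q ^ s := zpow_add₀ hQ0 _ _
  rw [e1, e2, e3, e4, e5, e6]
  have := zpow_ne_zero j hQ0
  have := zpow_ne_zero s hQ0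
  field_simp
  ring

/-- The induction on m keeps s free because the recurrence also calls for s + 1. -/
theorem tsum_changeTerm (s : ℤ) (m : ℕ) :
    ∑' j, changeTerm Q s m j =
      qPochNeg Q (2 * m + s) * recipQPoch (Q ^ 2) m * recipQPoch (Q ^ 2) (m + s) := by
  induction m generalizing s with
  | zero =>
    rw [tsum_eq_single 0]
    · simp [changeTerm, recipQPoch_eq_qPochNeg_mul Q hQ s]
    · intro j hj
      rcases lt_or_gt_of_ne hj with h | h
      · simp [changeTerm, recipQPoch_of_neg Q h]
      · simp [changeTerm, recipQPoch_of_neg (Q ^ 2) (show -j < 0 by lia)]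
  | succ m ih =>
    have hQ2 : ‖Q ^ 2‖ < 1 := norm_pow_lt_one hQ two_ne_zero
    have h := ((summable_changeTerm Q s (m + 1)).hasSum.mul_left (1 - Q ^ (2 * ((m : ℤ) + 1)))).unique
      ((((summable_changeTerm Q s m).hasSum.add
        (((summable_changeTerm Q s m).hasSum.int_add (-1)).mul_left (Q ^ (2 * (m : ℤ) + s + 1)))).add
        (((summable_changeTerm Q (s + 1) m).hasSum.int_add (-1)).mul_left
          (Q ^ (2 * (m : ℤ) + s + 2) * (1 + Q ^ s)))).congr_fun fun j => by
        have := changeTerm_rec hQ0 hQ s (m + 1) j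
        rw [add_sub_cancel_right, show 2 * ((m : ℤ) + 1) + s - 1 = 2 * m + s + 1 by ring,
          show 2 * ((m : ℤ) + 1) + s = 2 * m + s + 2 by ring] at this
        rw [this]
        rfl)
    have n1 : 1 - Q ^ (2 * ((m : ℤ) + 1)) ≠ 0 :=
      one_sub_ne_zero_of_norm_lt_one (norm_zpow_lt_one hQ0 hQ (by lia))
    push_cast
    apply mul_left_cancel₀ n1
    rw [h, ih, ih]
    have r1 := recipQPoch_eq_mul_succ hQ2 m
    have r2 := recipQPoch_sub_one hQ2 (m + 1 + s)
    rw [pow_zpow_eq] at r1 r2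
    push_cast at r1 r2
    rw [show (m : ℤ) + 1 + s - 1 = m + s by ring] at r2
    rw [show (m : ℤ) + (s + 1) = m + 1 + s by ring, r1, r2]
    rcases lt_trichotomy ((m : ℤ) + 1 + s) 0 with hs | hs | hs
    · simp [recipQPoch_of_neg _ hs]
    -- Here 2m + s = m - 1 may be -1, where `qPochNeg` takes a default value and its recursion
    -- fails. The terms concerned carry the factor 1 - Q^0 = 0.
    · obtain rfl : s = -(m + 1) := by lia
      rw [show 2 * (m : ℤ) + (-(m + 1) + 1) = m by ring,
        show 2 * ((m : ℤ) + 1) + -(m + 1) = m + 1 by ring, qPochNeg_succ hQ0 (by lia),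
        add_neg_cancel, mul_zero, zpow_zero, zpow_neg,
        show 2 * (m : ℤ) + -(m + 1) + 2 = m + 1 by ring]
      have := zpow_ne_zero ((m : ℤ) + 1) hQ0
      field_simp
      ring
    · rw [show 2 * ((m : ℤ) + 1) + s = 2 * m + s + 1 + 1 by ring, ← add_assoc (2 * (m : ℤ)),
        qPochNeg_succ hQ0 (k := 2 * m + s + 1) (by lia),
        qPochNeg_succ hQ0 (k := 2 * m + s) (by lia),
        show 2 * ((m : ℤ) + 1 + s) = (2 * m + s + 2) + s by ring, zpow_add₀ hQ0 _ s,
        show 2 * (m : ℤ) + s + 1 + 1 = 2 * m + s + 2 by ring]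
      ring

/-- Summation of the base change of the kernel of Bailey's transform. -/
theorem hasSum_change_of_base (d N j : ℤ) :
    HasSum (fun k => Q ^ (k ^ 2 + d * k) * (recipQPoch (Q ^ 2) (N - k) * baileyKernel Q d k j))
      (qPochNeg Q (2 * N + d) * Q ^ (j ^ 2 + d * j) * baileyKernel (Q ^ 2) d N j) := by
  rcases lt_or_ge N j with h | h
  · rw [baileyKernel_eq_zero _ (Or.inl h), mul_zero]
    convert hasSum_zero using 2 with k
    rcases lt_or_ge k j with hk | hk
    · rw [baileyKernel_eq_zero _ (Or.inl hk), mul_zero, mul_zero]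
    · rw [recipQPoch_of_neg _ (by lia), zero_mul, mul_zero]
  · obtain ⟨m, hm⟩ : ∃ m : ℕ, N - j = m := ⟨(N - j).toNat, by lia⟩
    obtain rfl : N = m + j := by lia
    -- The substitution k ↦ k - j reduces the sum to `tsum_changeTerm` with s = 2j + d and m = N -
    -- j.
    have := ((summable_changeTerm Q (2 * j + d) m).hasSum.int_add (-j)).mul_left (Q ^ (j ^ 2 + d * j))
    rw [tsum_changeTerm hQ0 hQ] at this
    refine this.of_eq (fun k => ?_) ?_
    · rw [changeTerm, ← mul_assoc (Q ^ (j ^ 2 + d * j)), ← zpow_add₀ hQ0, baileyKernel]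
      have e1 : (m : ℤ) + j - k = m - (k + -j) := by ring
      have e2 : k + -j + (2 * j + d) = k + j + d := by ring
      have e3 : k ^ 2 + d * k = j ^ 2 + d * j + ((k + -j) ^ 2 + (2 * j + d) * (k + -j)) := by ring
      rw [e1, e2, ← e3, sub_eq_add_neg k j, mul_assoc (recipQPoch (Q ^ 2) _)]
    · rw [baileyKernel, show 2 * ((m : ℤ) + j) + d = 2 * m + (2 * j + d) by ring,
        add_sub_cancel_right, show (m : ℤ) + j + j + d = m + (2 * j + d) by ring]
      ring

omit hQ0 in
theorem baileyKernel_zero_succ (N j : ℤ) :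
    baileyKernel Q 0 N (j + 1) = (1 - Q ^ (N - j)) * baileyKernel Q 1 N j := by
  rw [baileyKernel, baileyKernel, ← sub_sub, recipQPoch_sub_one hQ, add_zero,
    add_assoc N j 1]
  ring

/-- Q^{k²} = Q^{-j} Q^{k²+k} + Q^{k²}(1 - Q^{k-j}) combines the case d = 1 at j with the case d = 0
at j + 1. On the right the two terms containing Q^{2N+1} cancel. -/
theorem hasSum_change_of_base_shifted {N : ℤ} (hN : 0 ≤ N) (j : ℤ) :
    HasSum (fun k => Q ^ (k ^ 2) * (recipQPoch (Q ^ 2) (N - k) * baileyKernel Q 1 k j))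
      (qPochNeg Q (2 * N) * (Q ^ (j ^ 2) * (1 + Q ^ (2 * j + 1))) *
        baileyKernel (Q ^ 2) 1 N j) := by
  have h1 := (hasSum_change_of_base hQ0 hQ 1 N j).mul_left (Q ^ (-j))
  have h2 := hasSum_change_of_base hQ0 hQ 0 N (j + 1)
  have hQ2 : ‖Q ^ 2‖ < 1 := norm_pow_lt_one hQ two_ne_zero
  refine (h1.add h2).of_eq (fun k => ?_) ?_
  · rw [baileyKernel_zero_succ hQ, one_mul, zero_mul, add_zero, zpow_add₀ hQ0 (k ^ 2),
      sub_eq_add_neg k j, zpow_add₀ hQ0 k, zpow_neg]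
    have := zpow_ne_zero j hQ0
    field_simp
    ring
  · rw [baileyKernel_zero_succ hQ2, pow_zpow_eq, one_mul, zero_mul, add_zero,
      add_zero, qPochNeg_succ hQ0 (by lia)]
    have e1 : Q ^ (((2 : ℕ) : ℤ) * (N - j)) = Q ^ (2 * N + 1) * (Q ^ (2 * j + 1))⁻¹ := by
      rw [← zpow_neg, ← zpow_add₀ hQ0]; congr 1; push_cast; ring
    have e2 : Q ^ ((j + 1) ^ 2) = Q ^ (j ^ 2) * Q ^ (2 * j + 1) := by
      rw [← zpow_add₀ hQ0]; congr 1; ring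
    have e3 : Q ^ (j ^ 2 + j) = Q ^ (j ^ 2) * Q ^ j := zpow_add₀ hQ0 _ _
    rw [e1, e2, e3, zpow_neg]
    have := zpow_ne_zero j hQ0
    have := zpow_ne_zero (2 * j + 1) hQ0
    field_simp
    ring

end

/-! ### Limiting form of Bailey's transform -/

/-- The summand `q^(m² + s m) / ((q;q)_m (q;q)_{m+s})` of Cauchy's identity. -/
noncomputable def cauchyTerm (q : ℂ) (s m : ℤ) : ℂ :=
  q ^ (m ^ 2 + s * m) * (recipQPoch q m * recipQPoch q (m + s))

theorem summable_quadratic_mul_baileyKernel {q : ℂ} (hq0 : q ≠ 0) (hq : ‖q‖ < 1) (e d j : ℤ) :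
    Summable fun n : ℤ => q ^ (n ^ 2 + e * n) * baileyKernel q d n j := by
  obtain ⟨C, -, hC⟩ := exists_norm_baileyKernel_le hq
  have h := summable_zpow_quadratic hq0 hq zero_lt_one e
  refine Summable.of_norm_bounded (h.norm.mul_right C) fun n => ?_
  rw [norm_mul, one_mul]
  exact mul_le_mul_of_nonneg_left (hC _ _ _) (norm_nonneg _)

theorem cauchyTerm_eq (q : ℂ) (s m : ℤ) :
    cauchyTerm q s m = q ^ (m ^ 2 + s * m) * baileyKernel q s m 0 := by
  rw [cauchyTerm, baileyKernel, sub_zero, add_zero]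

section
variable {q : ℂ} (hq0 : q ≠ 0) (hq : ‖q‖ < 1)
include hq0 hq

theorem summable_cauchyTerm (s : ℤ) : Summable (cauchyTerm q s) :=
  (summable_quadratic_mul_baileyKernel hq0 hq s s 0).congr fun m =>
    (cauchyTerm_eq q s m).symm

/-- Both sides equal q^{-m} times the term at (s, m). -/
theorem cauchyTerm_rec (s m : ℤ) :
    cauchyTerm q s m + q ^ s * cauchyTerm q (s + 1) (m - 1) =
      cauchyTerm q (s - 1) m + q ^ s * cauchyTerm q s m := by
  have h1 := recipQPoch_sub_one hq m
  have h2 := recipQPoch_sub_one hq (m + s)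
  simp only [cauchyTerm]
  rw [show m - 1 + (s + 1) = m + s by ring, show m + (s - 1) = m + s - 1 by ring, h1, h2]
  have e1 : q ^ (m ^ 2 + (s - 1) * m) = q ^ (m ^ 2 + s * m) * (q ^ m)⁻¹ := by
    rw [← zpow_neg, ← zpow_add₀ hq0]; congr 1; ring
  have e2 : q ^ ((m - 1) ^ 2 + (s + 1) * (m - 1)) =
      q ^ (m ^ 2 + s * m) * (q ^ m)⁻¹ * (q ^ s)⁻¹ := by
    rw [← zpow_neg, ← zpow_neg, ← zpow_add₀ hq0, ← zpow_add₀ hq0]; congr 1; ring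
  rw [e1, e2, zpow_add₀ hq0 m s]
  have := zpow_ne_zero m hq0
  have := zpow_ne_zero s hq0
  field_simp
  ring

theorem tsum_cauchyTerm_rec (s : ℤ) :
    ∑' m, cauchyTerm q (s - 1) m - ∑' m, cauchyTerm q s m =
      -q ^ s * (∑' m, cauchyTerm q s m - ∑' m, cauchyTerm q (s + 1) m) := by
  have hs := (summable_cauchyTerm hq0 hq s).hasSum
  have h := (hs.add (((summable_cauchyTerm hq0 hq (s + 1)).hasSum.int_add (-1)).mul_left (q ^ s))).unique
    (((summable_cauchyTerm hq0 hq (s - 1)).hasSum.add (hs.mul_left (q ^ s))).congr_fun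
      (cauchyTerm_rec hq0 hq s))
  linear_combination -h

/-- The factor q^{sm} kills every m > 0 as s → ∞, so only m = 0 survives. -/
theorem tendsto_tsum_cauchyTerm :
    Tendsto (fun s : ℕ => ∑' m, cauchyTerm q s m) atTop (𝓝 (qPochInf q q)⁻¹) := by
  obtain ⟨C, hC0, hC⟩ := exists_norm_recipQPoch_le hq
  have hR := tendsto_recipQPoch hq
  have cast : Tendsto (fun n : ℕ => (n : ℤ)) atTop atTop := tendsto_natCast_atTop_atTop
  have e : ∑' m : ℤ, (if m = 0 then (qPochInf q q)⁻¹ else 0) = (qPochInf q q)⁻¹ := tsum_ite_eq 0 _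
  rw [← e]
  have hb := (summable_zpow_quadratic hq0 hq zero_lt_one 0).norm.mul_right (C * C)
  refine tendsto_tsum_of_dominated_convergence hb (fun m => ?_)
    (Eventually.of_forall fun s m => ?_)
  · rcases lt_trichotomy m 0 with hm | rfl | hm
    · rw [if_neg hm.ne]
      simp only [cauchyTerm, recipQPoch_of_neg _ hm, zero_mul, mul_zero]
      exact tendsto_const_nhds
    · simp only [cauchyTerm, recipQPoch_zero, if_true]
      simpa [Function.comp_def] using hR.comp cast
    · rw [if_neg hm.ne']
      have l1 : Tendsto (fun s : ℕ => q ^ (m ^ 2) * (q ^ m) ^ s * (recipQPoch q m *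
          recipQPoch q (m + s))) atTop
          (𝓝 (q ^ (m ^ 2) * 0 * (recipQPoch q m * (qPochInf q q)⁻¹))) := by
        refine Tendsto.mul (Tendsto.const_mul _ ?_) (Tendsto.const_mul _ (hR.comp ?_))
        · exact tendsto_pow_atTop_nhds_zero_of_norm_lt_one (norm_zpow_lt_one hq0 hq hm)
        · exact tendsto_atTop_add_const_left _ m cast
      rw [mul_zero, zero_mul] at l1
      refine l1.congr fun s => ?_
      rw [cauchyTerm, ← zpow_natCast, ← zpow_mul, ← zpow_add₀ hq0, mul_comm (s : ℤ)]
  · rcases lt_or_ge m 0 with hm | hm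
    · rw [cauchyTerm, recipQPoch_of_neg _ hm, zero_mul, mul_zero, norm_zero]
      positivity
    · rw [cauchyTerm, norm_mul, norm_mul, norm_zpow, norm_zpow]
      refine mul_le_mul ?_ (mul_le_mul (hC _) (hC _) (norm_nonneg _) hC0) (by positivity)
        (by positivity)
      refine zpow_le_zpow_right_of_le_one₀ (norm_pos_iff.mpr hq0) hq.le ?_
      have : 0 ≤ (s : ℤ) * m := mul_nonneg (Int.natCast_nonneg s) hm
      lia

/-- Consecutive differences in s satisfy D(s) = -q^{s+1} D(s+1), so |D| is nondecreasing; it also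
tends to 0, hence vanishes. The sum is therefore constant in s and equal to its limit. -/
theorem tsum_cauchyTerm_natCast (s : ℕ) : ∑' m, cauchyTerm q s m = (qPochInf q q)⁻¹ := by
  have hT := tendsto_tsum_cauchyTerm hq0 hq
  have hD : Tendsto (fun s : ℕ => ‖∑' m, cauchyTerm q s m - ∑' m, cauchyTerm q (s + 1 : ℕ) m‖) atTop
      (𝓝 0) := by
    have := (hT.sub (hT.comp (tendsto_add_atTop_nat 1))).norm
    rwa [sub_self, norm_zero] at this
  have hmono : Monotone fun s : ℕ =>
      ‖∑' m, cauchyTerm q s m - ∑' m, cauchyTerm q (s + 1 : ℕ) m‖ := by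
    refine monotone_nat_of_le_succ fun s => ?_
    have h := tsum_cauchyTerm_rec hq0 hq (s + 1)
    rw [add_sub_cancel_right] at h
    push_cast
    rw [h, norm_mul, norm_neg]
    exact mul_le_of_le_one_left (norm_nonneg _) (norm_zpow_lt_one hq0 hq (by lia)).le
  have hstep : ∀ s : ℕ, ∑' m, cauchyTerm q s m = ∑' m, cauchyTerm q (s + 1 : ℕ) m := fun s =>
    sub_eq_zero.mp (norm_le_zero_iff.mp (hmono.ge_of_tendsto hD s))
  have hconst : ∀ k : ℕ, ∑' m, cauchyTerm q s m = ∑' m, cauchyTerm q (s + k : ℕ) m := fun k => by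
    induction k with
    | zero => rfl
    | succ k ih => rw [ih, hstep]; rfl
  refine tendsto_nhds_unique (tendsto_const_nhds.congr fun k => ?_)
    (hT.comp (tendsto_add_atTop_nat s))
  rw [hconst k, add_comm]; rfl

theorem tsum_cauchyTerm (s : ℤ) : ∑' m, cauchyTerm q s m = (qPochInf q q)⁻¹ := by
  obtain ⟨k, rfl | rfl⟩ := s.eq_nat_or_neg
  · exact tsum_cauchyTerm_natCast hq0 hq k
  -- For s = -k, shifting m by k exchanges the two reciprocal factors.
  · rw [← tsum_cauchyTerm_natCast hq0 hq k, ← tsum_int_add (k : ℤ)]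
    congr 1; ext m
    rw [cauchyTerm, cauchyTerm, add_neg_cancel_right, mul_comm (recipQPoch q m)]
    congr 2; ring

/-- The limiting form of Bailey's transform. -/
theorem hasSum_bailey (d j : ℤ) : HasSum (fun n => q ^ (n ^ 2 + d * n) * baileyKernel q d n j)
    (q ^ (j ^ 2 + d * j) * (qPochInf q q)⁻¹) := by
  have h := ((summable_cauchyTerm hq0 hq (2 * j + d)).hasSum.int_add (-j)).mul_left
    (q ^ (j ^ 2 + d * j))
  rw [tsum_cauchyTerm hq0 hq] at h
  refine h.of_eq (fun n => ?_) rfl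
  rw [cauchyTerm, ← mul_assoc, ← zpow_add₀ hq0, baileyKernel, ← sub_eq_add_neg,
    show n - j + (2 * j + d) = n + j + d by ring]
  congr 2; ring

/-- The splitting q^{n²} = q^{-j} q^{n²+n} + q^{n²}(1 - q^{n-j}) again mixes d = 1 at j with d = 0
at j + 1. `hasSum_bailey_zero_shifted` uses the analogue for q^{n²-n}, whose second part is the case
d = 1 at n - 1. -/
theorem hasSum_bailey_one_shifted (j : ℤ) :
    HasSum (fun n => q ^ (n ^ 2) * baileyKernel q 1 n j)
      ((q ^ (j ^ 2) + q ^ ((j + 1) ^ 2)) * (qPochInf q q)⁻¹) := by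
  refine (((hasSum_bailey hq0 hq 1 j).mul_left (q ^ (-j))).add
    (hasSum_bailey hq0 hq 0 (j + 1))).of_eq (fun n => ?_) ?_
  · rw [baileyKernel_zero_succ hq, zero_mul, add_zero, one_mul, zpow_add₀ hq0 (n ^ 2),
      zpow_sub₀ hq0, zpow_neg]
    have := zpow_ne_zero j hq0
    field_simp
    ring
  · rw [zero_mul, add_zero, one_mul, zpow_add₀ hq0 (j ^ 2), zpow_neg]
    have := zpow_ne_zero j hq0
    field_simp

theorem hasSum_bailey_zero_shifted (j : ℤ) :
    HasSum (fun n => q ^ (n ^ 2 - n) * baileyKernel q 0 n j)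
      ((q ^ (j ^ 2 - j) + q ^ (j ^ 2 + j)) * (qPochInf q q)⁻¹) := by
  refine (((hasSum_bailey hq0 hq 0 j).mul_left (q ^ (-j))).add
    ((hasSum_bailey hq0 hq 1 j).int_add (-1))).of_eq (fun n => ?_) ?_
  · have h := recipQPoch_sub_one hq (n - j)
    rw [baileyKernel, baileyKernel, show n + -1 - j = n - j - 1 by ring, h,
      show n + -1 + j + 1 = n + j + 0 by ring,
      show (n + -1) ^ 2 + 1 * (n + -1) = n ^ 2 - n by ring, zpow_sub₀ hq0, zpow_sub₀ hq0, zero_mul,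
      add_zero, zpow_neg]
    have := zpow_ne_zero j hq0
    have := zpow_ne_zero n hq0
    field_simp
    ring_nf
  · rw [zero_mul, add_zero, one_mul, sub_eq_add_neg, zpow_add₀ hq0 (j ^ 2)]
    ring

end

/-! ### The iterated transform -/

theorem summable_changed_pair (Q : ℂ) (y a : ℤ → ℂ) {d : ℤ} (N : ℤ) (hd : d ≤ 1) :
    Summable fun z : ℤ × ℤ =>
      y z.1 * recipQPoch (Q ^ 2) (N - z.1) * (a z.2 * baileyKernel Q d z.1 z.2) := by
  refine summable_of_hasFiniteSupport
    (((Set.finite_Icc 0 N).prod (Set.finite_Icc (-N - 1) N)).subset fun z hz => ?_)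
  by_contra h
  simp only [Set.mem_prod, Set.mem_Icc, not_and_or, not_le] at h
  apply hz
  by_cases h1 : N < z.1
  · simp [recipQPoch_of_neg (Q ^ 2) (show N - z.1 < 0 by lia)]
  · simp [baileyKernel_eq_zero Q (d := d) (n := z.1) (j := z.2) (by lia)]

/-- The change of base applied to a Bailey pair `(a, β)`. -/
theorem tsum_changed_pair {Q : ℂ} {d : ℤ} (hd : d ≤ 1) {a β y e v c : ℤ → ℂ} {N : ℤ}
    (hβ : ∀ r, β r = ∑' j, a j * baileyKernel Q d r j)
    (hy : ∀ j, 0 ≤ N → HasSum (fun r => e N * y r * (recipQPoch (Q ^ 2) (N - r) *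
      baileyKernel Q d r j)) (v N * c j * baileyKernel (Q ^ 2) d N j)) :
    ∑' r, e N * y r * recipQPoch (Q ^ 2) (N - r) * β r =
      ∑' j, v N * (a j * c j) * baileyKernel (Q ^ 2) d N j := by
  rcases lt_or_ge N 0 with hN | hN
  · have z1 : ∀ r, e N * y r * recipQPoch (Q ^ 2) (N - r) * β r = 0 := fun r => by
      rcases lt_or_ge r 0 with hr | hr
      · have h0 : ∀ j, a j * baileyKernel Q d r j = 0 := fun j => by
          rw [baileyKernel_eq_zero _ (by lia), mul_zero]
        rw [hβ, tsum_congr h0, tsum_zero, mul_zero]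
      · rw [recipQPoch_of_neg _ (by lia), mul_zero, zero_mul]
    have z2 : ∀ j, v N * (a j * c j) * baileyKernel (Q ^ 2) d N j = 0 := fun j => by
      rw [baileyKernel_eq_zero _ (by lia), mul_zero]
    rw [tsum_congr z1, tsum_congr z2]
  · have hsum := summable_changed_pair Q (fun r => e N * y r) a N hd
    calc ∑' r, e N * y r * recipQPoch (Q ^ 2) (N - r) * β r
        = ∑' r, ∑' j, e N * y r * recipQPoch (Q ^ 2) (N - r) * (a j * baileyKernel Q d r j) := by
          refine tsum_congr fun r => ?_
          rw [hβ, tsum_mul_left]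
      _ = ∑' j, ∑' r, e N * y r * recipQPoch (Q ^ 2) (N - r) * (a j * baileyKernel Q d r j) :=
          (Summable.tsum_comm (f := fun r j =>
            e N * y r * recipQPoch (Q ^ 2) (N - r) * (a j * baileyKernel Q d r j)) hsum).symm
      _ = _ := by
          refine tsum_congr fun j => ?_
          refine (((hy j hN).mul_left (a j)).of_eq (fun r => ?_) ?_).tsum_eq <;> ring

/-- A Bailey pair `(a, β)`, a change of base and a final summation over `N`, combined. -/
theorem hasSum_iterated_bailey {Q : ℂ} (hQ : ‖Q‖ < 1) {d : ℤ} (hd : d ≤ 1)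
    {a β y e v c w l : ℤ → ℂ}
    (hβ : ∀ r, β r = ∑' j, a j * baileyKernel Q d r j)
    (hy : ∀ N j, 0 ≤ N → HasSum (fun r => e N * y r * (recipQPoch (Q ^ 2) (N - r) *
      baileyKernel Q d r j)) (v N * c j * baileyKernel (Q ^ 2) d N j))
    (hw : ∀ j, HasSum (fun N => w N * v N * baileyKernel (Q ^ 2) d N j) (l j))
    (hs : Summable fun z : ℤ × ℤ =>
      w z.1 * (e z.1 * y z.2 * recipQPoch (Q ^ 2) (z.1 - z.2) * β z.2))
    (hwv : Summable fun N => w N * v N) (hac : Summable fun j => a j * c j) :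
    HasSum (fun z : ℤ × ℤ =>
      w z.1 * (e z.1 * y z.2 * recipQPoch (Q ^ 2) (z.1 - z.2) * β z.2)) (∑' j, a j * c j * l j) := by
  obtain ⟨C, -, hC⟩ := exists_norm_baileyKernel_le (norm_pow_lt_one hQ two_ne_zero)
  have hs' : Summable fun z : ℤ × ℤ =>
      w z.1 * v z.1 * (a z.2 * c z.2) * baileyKernel (Q ^ 2) d z.1 z.2 :=
    summable_prod_mul_bounded (f := fun N => w N * v N) (g := fun j => a j * c j)
      (h := fun z : ℤ × ℤ => baileyKernel (Q ^ 2) d z.1 z.2) (C := C) hwv hac fun z => hC d z.1 z.2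
  -- Summing over r for fixed N replaces r by j; after interchanging N and j, the sum over N is
  -- `hw`.
  have h1 := hs.tsum_prod
  have h2 := Summable.tsum_comm (f := fun N j =>
    w N * v N * (a j * c j) * baileyKernel (Q ^ 2) d N j) hs'
  have h3 : ∀ N, ∑' r, w N * (e N * y r * recipQPoch (Q ^ 2) (N - r) * β r) =
      ∑' j, w N * v N * (a j * c j) * baileyKernel (Q ^ 2) d N j := fun N => by
    rw [tsum_mul_left, tsum_changed_pair (e := e) (v := v) hd hβ (hy N), ← tsum_mul_left]
    refine tsum_congr fun j => ?_
    ring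
  have h4 : ∀ j, ∑' N, w N * v N * (a j * c j) * baileyKernel (Q ^ 2) d N j =
      a j * c j * l j := fun j => by
    refine (((hw j).mul_left (a j * c j)).of_eq (fun N => ?_) rfl).tsum_eq
    ring
  have h5 := hs.hasSum
  rwa [h1, tsum_congr h3, ← h2, tsum_congr h4] at h5

/-! ### Double series with theta function values -/

/-- The theta series `∑ (-1)^j x^(15 j² + c j)`. -/
noncomputable def theta15 (x : ℂ) (c : ℤ) : ℂ := ∑' j, thetaTerm x 15 c j

/-- `1 / (x⁸;x⁸)_∞`. -/
noncomputable def invEta (x : ℂ) : ℂ := (qPochInf ((x ^ 4) ^ 2) ((x ^ 4) ^ 2))⁻¹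

/-- The general double series term of the change of base, in powers of `x`. -/
noncomputable def quadTerm (x : ℂ) (α γ : ℤ) (e β : ℤ → ℂ) (z : ℤ × ℤ) : ℂ :=
  x ^ (8 * z.1 ^ 2 + α * z.1) *
    (e z.1 * x ^ (4 * z.2 ^ 2 + γ * z.2) * recipQPoch ((x ^ 4) ^ 2) (z.1 - z.2) * β z.2)

/-- `1 / (-x⁴;x⁴)_{2N+i}`. -/
noncomputable def invNeg (x : ℂ) (i N : ℤ) : ℂ := qPochInv (-x ^ 4) (x ^ 4) (2 * N + i)

section
variable {x : ℂ} (hx0 : x ≠ 0) (hx : ‖x‖ < 1)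
include hx0

omit hx0 in
theorem theta15_neg (c : ℤ) : theta15 x (-c) = theta15 x c := by
  rw [theta15, ← tsum_int_sub_left 0]
  simp only [zero_sub, thetaTerm_neg, neg_neg]
  rfl

theorem theta15_reflect (c : ℤ) : theta15 x c = -x ^ (15 - c) * theta15 x (30 - c) := by
  rw [theta15, ← tsum_int_sub_left (-1)]
  simp only [thetaTerm_neg_one_sub hx0]
  rw [tsum_mul_left]
  rfl

theorem theta15_fifteen : theta15 x 15 = 0 := by
  have := theta15_reflect hx0 15
  norm_num at this
  linear_combination this / 2

include hx

theorem hasSum_theta15 (c : ℤ) : HasSum (thetaTerm x 15 c) (theta15 x c) :=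
  (summable_thetaTerm hx0 hx (by norm_num) c).hasSum

theorem theta15_eq_qPochInf₃ (a b : ℕ) {c : ℤ} (hab : a + b = 15) (hc : c = b - a) :
    theta15 x c = qPochInf₃ ((x ^ 2) ^ a) ((x ^ 2) ^ b) ((x ^ 2) ^ 15) ((x ^ 2) ^ 15) := by
  subst hc
  have hz : (x ^ 2) ^ a ≠ 0 := pow_ne_zero _ (pow_ne_zero _ hx0)
  have hb : (x ^ 2) ^ b = (x ^ 2) ^ 15 / (x ^ 2) ^ a := by
    rw [← hab, pow_add, mul_div_cancel_left₀ _ hz]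
  -- The triple product with z = q^a has weights with linear exponent a - b, so c is first replaced
  -- by -c.
  rw [← theta15_neg, neg_sub, hb]
  refine jacobi_triple_product (pow_ne_zero _ (pow_ne_zero _ hx0))
    (norm_pow_lt_one (norm_pow_lt_one hx two_ne_zero) (by norm_num)) hz ?_ (fun j => ?_)
    (summable_thetaTerm hx0 hx (by norm_num) _)
  · simp [thetaTerm]
  · rw [thetaTerm, thetaTerm, zpow_add_one₀ (by norm_num : (-1 : ℂ) ≠ 0), pow_zpow_eq, pow_zpow_eq,
      ← zpow_natCast (x ^ 2), pow_zpow_eq]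
    have : (15 : ℤ) * (j + 1) ^ 2 + (a - b) * (j + 1) =
        ((2 : ℕ) : ℤ) * a + ((2 : ℕ) : ℤ) * (((15 : ℕ) : ℤ) * j) + (15 * j ^ 2 + (a - b) * j) := by
      have : (b : ℤ) = 15 - a := by lia
      rw [this]; push_cast; ring
    rw [this, zpow_add₀ hx0, zpow_add₀ hx0]
    ring

theorem change_of_base (d N j : ℤ) (y : ℤ → ℂ)
    (hy : ∀ r, y r = x ^ (4 * r ^ 2 + 4 * d * r)) :
    HasSum (fun r => invNeg x d N * y r * (recipQPoch ((x ^ 4) ^ 2) (N - r) *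
      baileyKernel (x ^ 4) d r j))
      (1 * x ^ (4 * j ^ 2 + 4 * d * j) * baileyKernel ((x ^ 4) ^ 2) d N j) := by
  have h := (hasSum_change_of_base (pow_ne_zero 4 hx0) (norm_pow_lt_one hx four_ne_zero) d N j).mul_left
    (invNeg x d N)
  have h1 := qPochInv_mul_qPochNeg (norm_pow_lt_one hx four_ne_zero) (2 * N + d)
  refine h.of_eq (fun r => ?_) ?_
  · rw [hy, pow_zpow_eq, mul_assoc]
    congr 3; push_cast; ring
  · rw [← mul_assoc, ← mul_assoc, invNeg, h1, pow_zpow_eq]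
    congr 3; push_cast; ring

/-- Keeping the denominator (-x⁴;x⁴)_{2N} with a d = 1 pair leaves the last factor 1 + x^{8N+4} of
(-x⁴;x⁴)_{2N+1} uncancelled. -/
theorem change_of_base_odd_even {N : ℤ} (hN : 0 ≤ N) (j : ℤ) :
    HasSum (fun r => invNeg x 0 N * x ^ (4 * r ^ 2 + 4 * r) *
      (recipQPoch ((x ^ 4) ^ 2) (N - r) * baileyKernel (x ^ 4) 1 r j))
      ((1 + x ^ (8 * N + 4)) * x ^ (4 * j ^ 2 + 4 * j) * baileyKernel ((x ^ 4) ^ 2) 1 N j) := by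
  have h := (change_of_base hx0 hx 1 N j _ fun _ => rfl).mul_left (1 + x ^ (8 * N + 4))
  have h1 := qPochInv_eq_mul_succ (a := -x ^ 4) (by rw [norm_neg]; exact norm_pow_lt_one hx four_ne_zero)
    (norm_pow_lt_one hx four_ne_zero) (k := 2 * N) (by lia)
  rw [neg_mul, ← zpow_one_add₀ (pow_ne_zero 4 hx0), pow_zpow_eq,
    show ((4 : ℕ) : ℤ) * (1 + 2 * N) = 8 * N + 4 by push_cast; ring] at h1
  refine h.of_eq (fun r => ?_) ?_
  · rw [invNeg, invNeg, add_zero, h1, mul_one]; ring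
  · rw [mul_one]; ring

theorem change_of_base_shifted {N : ℤ} (hN : 0 ≤ N) (j : ℤ) :
    HasSum (fun r => invNeg x 0 N * x ^ (4 * r ^ 2 + 0 * r) *
      (recipQPoch ((x ^ 4) ^ 2) (N - r) * baileyKernel (x ^ 4) 1 r j))
      (1 * (x ^ (4 * j ^ 2) * (1 + x ^ (8 * j + 4))) * baileyKernel ((x ^ 4) ^ 2) 1 N j) := by
  have h := (hasSum_change_of_base_shifted (pow_ne_zero 4 hx0) (norm_pow_lt_one hx four_ne_zero)
    hN j).mul_left (invNeg x 0 N)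
  have h1 := qPochInv_mul_qPochNeg (norm_pow_lt_one hx four_ne_zero) (2 * N)
  refine h.of_eq (fun r => ?_) ?_
  · rw [pow_zpow_eq, mul_assoc, zero_mul, add_zero]; rfl
  · have e1 : ((4 : ℕ) : ℤ) * (2 * j + 1) = 8 * j + 4 := by push_cast; ring
    rw [invNeg, add_zero, pow_zpow_eq, pow_zpow_eq, e1, Nat.cast_ofNat]
    linear_combination -(x ^ (4 * j ^ 2) * (1 + x ^ (8 * j + 4)) *
      baileyKernel ((x ^ 4) ^ 2) 1 N j) * h1

theorem hasSum_bailey_pow (d j : ℤ) :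
    HasSum (fun N => x ^ (8 * N ^ 2 + 8 * d * N) * baileyKernel ((x ^ 4) ^ 2) d N j)
      (x ^ (8 * j ^ 2 + 8 * d * j) * invEta x) := by
  refine (hasSum_bailey (pow_ne_zero 2 (pow_ne_zero 4 hx0))
    (norm_pow_lt_one (norm_pow_lt_one hx four_ne_zero) two_ne_zero) d j).of_eq (fun N => ?_) ?_ <;>
  · rw [pow_zpow_eq, pow_zpow_eq]
    congr 2; push_cast; ring

omit hx0 in
theorem exists_norm_betaEven_le : ∃ C, ∀ r, ‖betaEven (x ^ 2) r‖ ≤ C := by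
  have hq := norm_pow_lt_one hx two_ne_zero
  obtain ⟨C, h0, hC⟩ := exists_norm_recipQPoch_le (norm_pow_lt_one hq two_ne_zero)
  obtain ⟨D, -, hD⟩ := exists_norm_qPochInv_le (a := -x ^ 2) (by rwa [norm_neg]) hq
  exact ⟨C * D, fun r => by
    rw [betaEven, norm_mul]; exact mul_le_mul (hC _) (hD _) (norm_nonneg _) h0⟩

omit hx0 in
theorem exists_norm_betaOdd_le : ∃ C, ∀ r, ‖betaOdd (x ^ 2) r‖ ≤ C := by
  have hq := norm_pow_lt_one hx two_ne_zero
  obtain ⟨C, h0, hC⟩ := exists_norm_recipQPoch_le (norm_pow_lt_one hq two_ne_zero)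
  obtain ⟨D, -, hD⟩ := exists_norm_qPochInv_le (a := -x ^ 2) (by rwa [norm_neg]) hq
  exact ⟨C * D, fun r => by
    rw [betaOdd, norm_mul]; exact mul_le_mul (hC _) (hD _) (norm_nonneg _) h0⟩

theorem summable_quadTerm (α γ i : ℤ) {β : ℤ → ℂ} (hβ : ∃ C, ∀ r, ‖β r‖ ≤ C) :
    Summable (quadTerm x α γ (invNeg x i) β) := by
  have hQ := norm_pow_lt_one hx four_ne_zero
  obtain ⟨B, hB⟩ := hβ
  obtain ⟨C, hC0, hC⟩ := exists_norm_recipQPoch_le (norm_pow_lt_one hQ two_ne_zero)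
  obtain ⟨D, hD0, hD⟩ := exists_norm_qPochInv_le (a := -x ^ 4) (by rwa [norm_neg]) hQ
  refine (summable_prod_mul_bounded (C := D * C * B)
    (h := fun z : ℤ × ℤ => invNeg x i z.1 * recipQPoch ((x ^ 4) ^ 2) (z.1 - z.2) * β z.2)
    (summable_zpow_quadratic hx0 hx (by norm_num : (0 : ℤ) < 8) α)
    (summable_zpow_quadratic hx0 hx (by norm_num : (0 : ℤ) < 4) γ) fun z => ?_).congr fun z => ?_
  · rw [norm_mul, norm_mul]
    exact mul_le_mul (mul_le_mul (hD _) (hC _) (norm_nonneg _) hD0) (hB _) (norm_nonneg _)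
      (mul_nonneg hD0 hC0)
  · rw [quadTerm]; ring

theorem summable_thetaTerm_mul_zpow {A : ℤ} (hA : 0 ≤ A) (c d : ℤ) :
    Summable fun j => thetaTerm x 3 c j * x ^ (A * j ^ 2 + d * j) := by
  refine (summable_thetaTerm hx0 hx (show 0 < 3 + A by lia) (c + d)).congr fun j => ?_
  rw [thetaTerm, thetaTerm, mul_assoc, ← zpow_add₀ hx0]
  congr 2; ring

end

section
variable {x : ℂ} (hx0 : x ≠ 0) (hx : ‖x‖ < 1)
include hx0

theorem thetaTerm_mul_zpow {A c A' c' j k m : ℤ}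
    (h : A * j ^ 2 + c * j + k = m + (A' * j ^ 2 + c' * j)) :
    thetaTerm x A c j * x ^ k = x ^ m * thetaTerm x A' c' j := by
  rw [thetaTerm, thetaTerm, mul_assoc, ← zpow_add₀ hx0, h, zpow_add₀ hx0]
  ring

include hx

/-- The exponents 3j² + cj, 4j² + 4dj and 8j² + 8dj add up to 15j² + (c + 12d)j. -/
theorem hasSum_quadTerm {d c : ℤ} (hd : d ≤ 1) {β : ℤ → ℂ}
    (hβ : ∀ r, β r = thetaBailey x d c r)
    (hs : Summable (quadTerm x (8 * d) (4 * d) (invNeg x d) β)) :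
    HasSum (quadTerm x (8 * d) (4 * d) (invNeg x d) β) (theta15 x (c + 12 * d) * invEta x) := by
  have h := hasSum_iterated_bailey (norm_pow_lt_one hx four_ne_zero) hd (β := β)
    (a := thetaTerm x 3 c) (y := fun r => x ^ (4 * r ^ 2 + 4 * d * r)) (e := invNeg x d)
    (v := fun _ => 1) (c := fun j => x ^ (4 * j ^ 2 + 4 * d * j))
    (w := fun N => x ^ (8 * N ^ 2 + 8 * d * N))
    (l := fun j => x ^ (8 * j ^ 2 + 8 * d * j) * invEta x) hβ
    (fun N j _ => change_of_base hx0 hx d N j _ fun _ => rfl)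
    (fun j => by simpa only [mul_one] using hasSum_bailey_pow hx0 hx d j) hs
    (by simpa only [mul_one] using summable_zpow_quadratic hx0 hx (by norm_num) (8 * d))
    (summable_thetaTerm_mul_zpow hx0 hx (by norm_num) _ _)
  refine h.of_eq (fun _ => rfl) ?_
  refine Eq.symm (((hasSum_theta15 hx0 hx (c + 12 * d)).mul_right (invEta x)).of_eq
    (fun j => ?_) rfl).tsum_eq
  rw [← mul_assoc, mul_assoc (thetaTerm x 3 c j), ← zpow_add₀ hx0,
    thetaTerm_mul_zpow hx0 (m := 0) (A' := 15) (c' := c + 12 * d) (by ring), zpow_zero, one_mul]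

theorem summable_thetaTerm_mul_shift (c : ℤ) :
    Summable fun j => thetaTerm x 3 c j * (x ^ (4 * j ^ 2) * (1 + x ^ (8 * j + 4))) := by
  refine ((summable_thetaTerm hx0 hx (show (0 : ℤ) < 7 by norm_num) c).add
    ((summable_thetaTerm hx0 hx (show (0 : ℤ) < 7 by norm_num) (c + 8)).mul_left (x ^ (4 : ℤ)))).congr
    fun j => ?_
  rw [mul_add, mul_one, ← zpow_add₀ hx0, mul_add,
    thetaTerm_mul_zpow hx0 (m := 0) (A' := 7) (c' := c) (by ring),
    thetaTerm_mul_zpow hx0 (m := 4) (A' := 7) (c' := c + 8) (by ring), zpow_zero, one_mul]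

theorem hasSum_quadTerm_shifted {c : ℤ} {β : ℤ → ℂ} (hβ : ∀ r, β r = thetaBailey x 1 c r)
    (hs : Summable (quadTerm x 8 0 (invNeg x 0) β)) :
    HasSum (quadTerm x 8 0 (invNeg x 0) β)
      ((theta15 x (c + 8) + x ^ 4 * theta15 x (c + 16)) * invEta x) := by
  have h := hasSum_iterated_bailey (norm_pow_lt_one hx four_ne_zero) le_rfl (β := β)
    (a := thetaTerm x 3 c) (y := fun r => x ^ (4 * r ^ 2 + 0 * r)) (e := invNeg x 0)
    (v := fun _ => 1) (c := fun j => x ^ (4 * j ^ 2) * (1 + x ^ (8 * j + 4)))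
    (w := fun N => x ^ (8 * N ^ 2 + 8 * N))
    (l := fun j => x ^ (8 * j ^ 2 + 8 * j) * invEta x) hβ
    (fun N j hN => change_of_base_shifted hx0 hx hN j)
    (fun j => by simpa only [mul_one] using hasSum_bailey_pow hx0 hx 1 j) hs
    (by simpa only [mul_one] using summable_zpow_quadratic hx0 hx (by norm_num) 8)
    (summable_thetaTerm_mul_shift hx0 hx c)
  refine h.of_eq (fun _ => rfl) ?_
  refine Eq.symm ((((hasSum_theta15 hx0 hx (c + 8)).add ((hasSum_theta15 hx0 hx (c + 16)).mul_left
    (x ^ 4))).mul_right (invEta x)).of_eq (fun j => ?_) rfl).tsum_eq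
  have e1 := thetaTerm_mul_zpow hx0 (A := 3) (c := c) (j := j)
    (k := 4 * j ^ 2 + (8 * j ^ 2 + 8 * j)) (m := 0) (A' := 15) (c' := c + 8) (by ring)
  have e2 := thetaTerm_mul_zpow hx0 (A := 3) (c := c) (j := j)
    (k := 4 * j ^ 2 + (8 * j + 4) + (8 * j ^ 2 + 8 * j)) (m := 4) (A' := 15) (c' := c + 16) (by ring)
  rw [zpow_add₀ hx0, zpow_zero, one_mul] at e1
  rw [zpow_add₀ hx0, zpow_add₀ hx0, zpow_ofNat] at e2
  linear_combination invEta x * (e1 + e2)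

theorem hasSum_quadTerm_odd_even :
    HasSum (quadTerm x 0 4 (invNeg x 0) (betaOdd (x ^ 2)))
      ((theta15 x 5 + x ^ 8 * theta15 x 21 + x ^ 4 * theta15 x 13) * invEta x) := by
  have hw : ∀ j, HasSum (fun N => x ^ (8 * N ^ 2 + 0 * N) * (1 + x ^ (8 * N + 4)) *
      baileyKernel ((x ^ 4) ^ 2) 1 N j)
      ((x ^ (8 * j ^ 2) + x ^ (8 * (j + 1) ^ 2) + x ^ 4 * x ^ (8 * j ^ 2 + 8 * j)) * invEta x) := by
    intro j
    have h1 := hasSum_bailey_one_shifted (pow_ne_zero 2 (pow_ne_zero 4 hx0))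
      (norm_pow_lt_one (norm_pow_lt_one hx four_ne_zero) two_ne_zero) j
    have h2 := (hasSum_bailey_pow hx0 hx 1 j).mul_left (x ^ 4)
    refine (h1.add h2).of_eq (fun N => ?_) ?_
    · have e : x ^ (8 * N ^ 2) * x ^ (8 * N + 4) = x ^ 4 * x ^ (8 * N ^ 2 + 8 * 1 * N) := by
        rw [← zpow_natCast x 4, ← zpow_add₀ hx0, ← zpow_add₀ hx0]; congr 1; push_cast; ring
      rw [pow_zpow_eq, pow_zpow_eq, zero_mul, add_zero,
        show ((4 : ℕ) : ℤ) * (((2 : ℕ) : ℤ) * N ^ 2) = 8 * N ^ 2 by push_cast; ring]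
      linear_combination baileyKernel ((x ^ 4) ^ 2) 1 N j * e
    · simp only [pow_zpow_eq]
      rw [show ((4 : ℕ) : ℤ) * (((2 : ℕ) : ℤ) * j ^ 2) = 8 * j ^ 2 by push_cast; ring,
        show ((4 : ℕ) : ℤ) * (((2 : ℕ) : ℤ) * (j + 1) ^ 2) = 8 * (j + 1) ^ 2 by push_cast; ring,
        invEta]
      ring_nf
  have hwv : Summable fun N : ℤ => x ^ (8 * N ^ 2 + 0 * N) * (1 + x ^ (8 * N + 4)) := by
    refine ((summable_zpow_quadratic hx0 hx (show (0 : ℤ) < 8 by norm_num) 0).add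
      ((summable_zpow_quadratic hx0 hx (show (0 : ℤ) < 8 by norm_num) 8).mul_left
        (x ^ (4 : ℤ)))).congr fun N => ?_
    rw [mul_add, mul_one, ← zpow_add₀ hx0, ← zpow_add₀ hx0]
    congr 2; ring
  have h := hasSum_iterated_bailey (norm_pow_lt_one hx four_ne_zero) le_rfl
    (β := betaOdd (x ^ 2)) (a := thetaTerm x 3 1) (y := fun r => x ^ (4 * r ^ 2 + 4 * r))
    (e := invNeg x 0) (v := fun N => 1 + x ^ (8 * N + 4)) (c := fun j => x ^ (4 * j ^ 2 + 4 * j))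
    (w := fun N => x ^ (8 * N ^ 2 + 0 * N)) (fun r => (thetaBailey_one_one hx0 hx r).symm)
    (fun N j hN => change_of_base_odd_even hx0 hx hN j) hw
    (summable_quadTerm hx0 hx 0 4 0 (exists_norm_betaOdd_le hx)) hwv
    (summable_thetaTerm_mul_zpow hx0 hx (by norm_num) _ _)
  refine h.of_eq (fun _ => rfl) ?_
  refine Eq.symm (((((hasSum_theta15 hx0 hx 5).add ((hasSum_theta15 hx0 hx 21).mul_left
    (x ^ 8))).add ((hasSum_theta15 hx0 hx 13).mul_left (x ^ 4))).mul_right (invEta x)).of_eq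
    (fun j => ?_) rfl).tsum_eq
  have e1 := thetaTerm_mul_zpow hx0 (A := 3) (c := 1) (j := j)
    (k := 4 * j ^ 2 + 4 * j + 8 * j ^ 2) (m := 0) (A' := 15) (c' := 5) (by ring)
  have e2 := thetaTerm_mul_zpow hx0 (A := 3) (c := 1) (j := j)
    (k := 4 * j ^ 2 + 4 * j + 8 * (j + 1) ^ 2) (m := 8) (A' := 15) (c' := 21) (by ring)
  have e3 := thetaTerm_mul_zpow hx0 (A := 3) (c := 1) (j := j)
    (k := 4 * j ^ 2 + 4 * j + (8 * j ^ 2 + 8 * j)) (m := 0) (A' := 15) (c' := 13) (by ring)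
  rw [zpow_add₀ hx0, zpow_zero, one_mul] at e1 e3
  rw [zpow_add₀ hx0, zpow_ofNat] at e2
  linear_combination invEta x * (e1 + e2 + x ^ 4 * e3)

theorem hasSum_quadTerm_neg :
    HasSum (quadTerm x (-8) 0 (invNeg x 0) (betaEven (x ^ 2)))
      ((theta15 x 7 + theta15 x 9) * invEta x) := by
  have hw : ∀ j, HasSum (fun N => x ^ (8 * N ^ 2 + -8 * N) * 1 *
      baileyKernel ((x ^ 4) ^ 2) 0 N j)
      ((x ^ (8 * j ^ 2 + -8 * j) + x ^ (8 * j ^ 2 + 8 * j)) * invEta x) := by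
    intro j
    refine (hasSum_bailey_zero_shifted (pow_ne_zero 2 (pow_ne_zero 4 hx0))
      (norm_pow_lt_one (norm_pow_lt_one hx four_ne_zero) two_ne_zero) j).of_eq (fun N => ?_) ?_
    · rw [pow_zpow_eq, pow_zpow_eq, mul_one]
      congr 2; push_cast; ring
    · simp only [pow_zpow_eq]
      rw [invEta]
      congr 3 <;> push_cast <;> ring
  have h := hasSum_iterated_bailey (norm_pow_lt_one hx four_ne_zero) zero_le_one
    (β := betaEven (x ^ 2)) (a := thetaTerm x 3 1) (y := fun r => x ^ (4 * r ^ 2 + 0 * r))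
    (e := invNeg x 0) (v := fun _ => 1) (c := fun j => x ^ (4 * j ^ 2 + 4 * 0 * j))
    (w := fun N => x ^ (8 * N ^ 2 + -8 * N)) (fun r => (thetaBailey_zero_one hx0 hx r).symm)
    (fun N j _ => change_of_base hx0 hx 0 N j _ fun _ => by ring_nf) hw
    (summable_quadTerm hx0 hx (-8) 0 0 (exists_norm_betaEven_le hx))
    (by simpa only [mul_one] using summable_zpow_quadratic hx0 hx (by norm_num) (-8))
    (summable_thetaTerm_mul_zpow hx0 hx (by norm_num) _ _)
  refine h.of_eq (fun _ => rfl) ?_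
  rw [← theta15_neg]
  refine Eq.symm ((((hasSum_theta15 hx0 hx (-7)).add (hasSum_theta15 hx0 hx 9)).mul_right
    (invEta x)).of_eq (fun j => ?_) rfl).tsum_eq
  have e1 := thetaTerm_mul_zpow hx0 (A := 3) (c := 1) (j := j)
    (k := 4 * j ^ 2 + 4 * 0 * j + (8 * j ^ 2 + -8 * j)) (m := 0) (A' := 15) (c' := -7) (by ring)
  have e2 := thetaTerm_mul_zpow hx0 (A := 3) (c := 1) (j := j)
    (k := 4 * j ^ 2 + 4 * 0 * j + (8 * j ^ 2 + 8 * j)) (m := 0) (A' := 15) (c' := 9) (by ring)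
  rw [zpow_add₀ hx0, zpow_zero, one_mul] at e1 e2
  linear_combination invEta x * (e1 + e2)

end

/-! ### The seven double series over `ℤ × ℤ` -/

section
variable {x : ℂ} (hx0 : x ≠ 0) (hx : ‖x‖ < 1)
include hx0 hx

theorem hasSum_quadTerm_one :
    HasSum (quadTerm x 0 0 (invNeg x 0) (betaEven (x ^ 2))) (theta15 x 1 * invEta x) :=
  hasSum_quadTerm hx0 hx (d := 0) (c := 1) zero_le_one
    (fun r => (thetaBailey_zero_one hx0 hx r).symm)
    (summable_quadTerm hx0 hx 0 0 0 (exists_norm_betaEven_le hx))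

theorem hasSum_quadTerm_three :
    HasSum (quadTerm x 0 4 (invNeg x 0) (betaEven (x ^ 2))) (theta15 x 3 * invEta x) := by
  have e : quadTerm x 0 4 (invNeg x 0) (betaEven (x ^ 2)) =
      quadTerm x (8 * 0) (4 * 0) (invNeg x 0) fun r => x ^ (4 * r) * betaEven (x ^ 2) r := by
    ext z
    rw [quadTerm, quadTerm, zpow_add₀ hx0 (4 * z.2 ^ 2), mul_zero, mul_zero, zero_mul, zero_mul,
      add_zero, add_zero]
    ring
  have hs := summable_quadTerm hx0 hx 0 4 0 (exists_norm_betaEven_le hx)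
  rw [e] at hs ⊢
  exact hasSum_quadTerm hx0 hx (d := 0) (c := 3) zero_le_one (fun r => by
    rw [thetaBailey_zero_three hx0 hx, thetaBailey_zero_one hx0 hx]) hs

theorem hasSum_quadTerm_eleven :
    HasSum (quadTerm x 8 4 (invNeg x 1) (betaEven (x ^ 2))) (theta15 x 11 * invEta x) := by
  have h := hasSum_quadTerm hx0 hx (d := 1) (c := -1) (β := betaEven (x ^ 2)) le_rfl
    (fun r => by rw [thetaBailey_one_neg_one hx0 hx, thetaBailey_zero_one hx0 hx])
  norm_num at h
  exact h (summable_quadTerm hx0 hx 8 4 1 (exists_norm_betaEven_le hx))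

theorem hasSum_quadTerm_thirteen :
    HasSum (quadTerm x 8 4 (invNeg x 1) (betaOdd (x ^ 2))) (theta15 x 13 * invEta x) := by
  have h := hasSum_quadTerm hx0 hx (d := 1) (c := 1) (β := betaOdd (x ^ 2)) le_rfl
    (fun r => (thetaBailey_one_one hx0 hx r).symm)
  norm_num at h
  exact h (summable_quadTerm hx0 hx 8 4 1 (exists_norm_betaOdd_le hx))

/-- The shifted transform with c = -1 yields θ(7) + x⁴θ(15), and θ(15) = 0. -/
theorem hasSum_quadTerm_seven :
    HasSum (quadTerm x 8 0 (invNeg x 0) (betaEven (x ^ 2))) (theta15 x 7 * invEta x) := by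
  have h := hasSum_quadTerm_shifted hx0 hx (c := -1)
    (fun r => by rw [thetaBailey_one_neg_one hx0 hx, thetaBailey_zero_one hx0 hx])
    (summable_quadTerm hx0 hx 8 0 0 (exists_norm_betaEven_le hx))
  norm_num [theta15_fifteen hx0] at h
  exact h

theorem hasSum_quadTerm_nine :
    HasSum (fun z => quadTerm x (-8) 0 (invNeg x 0) (betaEven (x ^ 2)) z -
      quadTerm x 8 0 (invNeg x 0) (betaEven (x ^ 2)) z) (theta15 x 9 * invEta x) :=
  ((hasSum_quadTerm_neg hx0 hx).sub (hasSum_quadTerm_seven hx0 hx)).of_eq (fun _ => rfl) (by ring)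

/-- The total is θ(5) + x⁸θ(21) + x⁴θ(13) + x²θ(9) + x⁶θ(17). By reflection x⁸θ(21) = -x²θ(9) and
x⁴θ(13) = -x⁶θ(17). -/
theorem hasSum_quadTerm_five :
    HasSum (fun z => quadTerm x 0 4 (invNeg x 0) (betaOdd (x ^ 2)) z +
      x ^ 2 * quadTerm x 8 0 (invNeg x 0) (betaOdd (x ^ 2)) z) (theta15 x 5 * invEta x) := by
  have h := hasSum_quadTerm_shifted hx0 hx (c := 1)
    (fun r => (thetaBailey_one_one hx0 hx r).symm)
    (summable_quadTerm hx0 hx 8 0 0 (exists_norm_betaOdd_le hx))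
  refine ((hasSum_quadTerm_odd_even hx0 hx).add (h.mul_left (x ^ 2))).of_eq (fun _ => rfl) ?_
  have h1 := theta15_reflect hx0 21
  have h2 := theta15_reflect hx0 13
  norm_num at h1 h2 ⊢
  rw [h1, h2]
  field_simp
  ring

end

/-! ### Passage to sums over `ℕ × ℕ` -/

/-- The map (n, r) ↦ (n + r, r) parametrizes the region 0 ≤ r ≤ N that carries the series. -/
theorem HasSum.nat_of_int {F : ℤ × ℤ → ℂ} {s : ℂ} (h : HasSum F s)
    (h0 : ∀ N r, r < 0 ∨ N < r → F (N, r) = 0) :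
    HasSum (fun p : ℕ × ℕ => F ((p.1 : ℤ) + p.2, p.2)) s := by
  have hi : Function.Injective fun p : ℕ × ℕ => ((p.1 : ℤ) + p.2, (p.2 : ℤ)) := by
    rintro ⟨a, b⟩ ⟨c, d⟩ h
    simp only [Prod.mk.injEq] at h ⊢
    lia
  refine (hi.hasSum_iff fun z hz => ?_).mpr h
  obtain ⟨N, r⟩ := z
  refine h0 N r ?_
  by_contra hc
  exact hz ⟨((N - r).toNat, r.toNat), by simp only [Prod.mk.injEq]; lia⟩

theorem HasSum.int_prod_add {F : ℤ × ℤ → ℂ} {s : ℂ} (h : HasSum F s) (a b : ℤ) :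
    HasSum (fun z : ℤ × ℤ => F (z.1 + a, z.2 + b)) s :=
  ((Equiv.addRight a).prodCongr (Equiv.addRight b)).hasSum_iff.mpr h

theorem quadTerm_eq_zero (x : ℂ) (α γ : ℤ) (e : ℤ → ℂ) {β : ℤ → ℂ} {N r : ℤ}
    (h : β r = 0 ∨ N < r) : quadTerm x α γ e β (N, r) = 0 := by
  rcases h with h | h
  · simp [quadTerm, h]
  · simp [quadTerm, recipQPoch_of_neg _ (show N - r < 0 by lia)]

theorem quadTerm_eq_pow {x : ℂ} (hx0 : x ≠ 0) {α γ : ℤ} (e β : ℤ → ℂ) {N r : ℤ} {m : ℕ}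
    (h : 8 * N ^ 2 + α * N + (4 * r ^ 2 + γ * r) = 2 * m) :
    quadTerm x α γ e β (N, r) =
      (x ^ 2) ^ m * (e N * recipQPoch ((x ^ 2) ^ 4) (N - r) * β r) := by
  have h1 : (x ^ 2) ^ m = x ^ (8 * N ^ 2 + α * N) * x ^ (4 * r ^ 2 + γ * r) := by
    rw [← zpow_add₀ hx0, h, ← pow_mul, ← zpow_natCast]; push_cast; rfl
  rw [quadTerm, h1, show (x ^ 2) ^ 4 = (x ^ 4) ^ 2 by ring]
  ring

theorem invNeg_natCast (x : ℂ) (i n r : ℕ) :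
    invNeg x i ((n : ℤ) + r) = (qPoch (-(x ^ 2) ^ 2) ((x ^ 2) ^ 2) (2 * n + 2 * r + i))⁻¹ := by
  rw [invNeg, show (2 : ℤ) * ((n : ℤ) + r) + i = ((2 * n + 2 * r + i : ℕ) : ℤ) by push_cast; ring,
    qPochInv_natCast, ← pow_mul]

theorem betaEven_natCast (q : ℂ) (r : ℕ) :
    betaEven q r = (qPoch (q ^ 2) (q ^ 2) r)⁻¹ * (qPoch (-q) q (2 * r))⁻¹ := by
  rw [betaEven, recipQPoch_natCast, show (2 : ℤ) * r = ((2 * r : ℕ) : ℤ) by push_cast; ring,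
    qPochInv_natCast]

theorem betaOdd_natCast (q : ℂ) (r : ℕ) :
    betaOdd q r = (qPoch (q ^ 2) (q ^ 2) r)⁻¹ * (qPoch (-q) q (2 * r + 1))⁻¹ := by
  rw [betaOdd, recipQPoch_natCast, show (2 : ℤ) * r + 1 = ((2 * r + 1 : ℕ) : ℤ) by push_cast; ring,
    qPochInv_natCast]

theorem qPoch_inv_eq_mul_succ {a q : ℂ} (ha : ‖a‖ < 1) (hq : ‖q‖ < 1) (m : ℕ) :
    (qPoch a q m)⁻¹ = (1 - a * q ^ m) * (qPoch a q (m + 1))⁻¹ := by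
  have h1 := qPoch_ne_zero ha hq m
  have h2 := one_sub_ne_zero_of_norm_lt_one (norm_mul_pow_lt_one ha hq m)
  rw [qPoch_succ]
  field_simp

theorem recipQPoch_natCast_sub_one {q : ℂ} (hq : ‖q‖ < 1) (n : ℕ) :
    recipQPoch q ((n : ℤ) - 1) = (1 - q ^ n) * (qPoch q q n)⁻¹ := by
  rw [recipQPoch_sub_one hq, recipQPoch_natCast, zpow_natCast]

/-! ### Special products -/

theorem qPoch_three_mul (a q : ℂ) (m : ℕ) : qPoch a q (3 * m) =
    qPoch a (q ^ 3) m * qPoch (a * q) (q ^ 3) m * qPoch (a * q ^ 2) (q ^ 3) m := by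
  induction m with
  | zero => simp
  | succ m ih =>
    rw [mul_add_one, qPoch_succ a q (3 * m + 2), qPoch_succ a q (3 * m + 1), qPoch_succ a q (3 * m),
      qPoch_succ, qPoch_succ, qPoch_succ, ih]
    ring

theorem qPochInf_eq_mul_three (a : ℂ) {q : ℂ} (hq : ‖q‖ < 1) :
    qPochInf a q = qPochInf₃ a (a * q) (q ^ 2 * a) (q ^ 3) := by
  have hq3 := norm_pow_lt_one hq three_ne_zero
  have h : Tendsto (fun m : ℕ => 3 * m) atTop atTop :=
    tendsto_id.const_mul_atTop' (by norm_num)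
  have h1 := (tendsto_qPoch a hq).comp h
  have h2 := ((tendsto_qPoch a hq3).mul (tendsto_qPoch (a * q) hq3)).mul
    (tendsto_qPoch (a * q ^ 2) hq3)
  rw [mul_comm (q ^ 2), qPochInf₃]
  exact tendsto_nhds_unique h1 (h2.congr fun m => (qPoch_three_mul a q m).symm)

theorem qPochInf_zero_left (q : ℂ) : qPochInf 0 q = 1 := by simp [qPochInf]

/-! ### The seven identities -/

section
variable {x : ℂ} (hx0 : x ≠ 0) (hx : ‖x‖ < 1)
include hx0 hx

/-- The series for θ(9), shifted by (1, 1), is modified by D(N, r) - D(N, r+1), where D is the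
summand for θ(11); this difference has total 0. -/
theorem hasSum_third :
    HasSum (fun p : ℕ × ℕ => let n := p.1; let r := p.2
        (x ^ 2) ^ (4 * n ^ 2 + 8 * n * r + 6 * r ^ 2 + 4 * n + 6 * r) *
            (1 + (x ^ 2) ^ (2 * r + 1) + 2 * (x ^ 2) ^ (2 * r + 2) + (x ^ 2) ^ (4 * r + 3) +
              (x ^ 2) ^ (4 * n + 4 * r + 4)) /
          (qPoch (-(x ^ 2) ^ 2) ((x ^ 2) ^ 2) (2 * n + 2 * r + 1) *
            qPoch ((x ^ 2) ^ 2) ((x ^ 2) ^ 2) r *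
            qPoch (-x ^ 2) (x ^ 2) (2 * r + 2) * qPoch ((x ^ 2) ^ 4) ((x ^ 2) ^ 4) n))
      (theta15 x 9 * invEta x) := by
  have hA := (hasSum_quadTerm_nine hx0 hx).int_prod_add 1 1
  have hD := hasSum_quadTerm_eleven hx0 hx
  have hF := hA.add (hD.sub (hD.int_prod_add 0 1))
  rw [sub_self, add_zero] at hF
  have hq0 : x ^ 2 ≠ 0 := pow_ne_zero 2 hx0
  have hq := norm_pow_lt_one hx two_ne_zero
  have hQ := norm_pow_lt_one hq two_ne_zero
  have hp := norm_pow_lt_one hq four_ne_zero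
  refine (hF.nat_of_int fun N r hr => ?_).of_eq (fun p => ?_) rfl
  · have z1 : ∀ s, s < 0 ∨ N < s → quadTerm x 8 4 (invNeg x 1) (betaEven (x ^ 2)) (N, s) = 0 :=
      fun s hs => quadTerm_eq_zero x _ _ _ (hs.imp_left (betaEven_of_neg _))
    have z2 : ∀ α, r < -1 ∨ N < r →
        quadTerm x α 0 (invNeg x 0) (betaEven (x ^ 2)) (N + 1, r + 1) = 0 := fun α hs =>
      quadTerm_eq_zero x _ _ _
        (hs.imp (fun h => betaEven_of_neg _ (by lia)) (fun h => by lia))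
    simp only [add_zero]
    rw [z1 r hr]
    rcases lt_or_ge N r with h | h
    · rw [z1 _ (by lia), z2 _ (Or.inr h), z2 _ (Or.inr h)]; ring
    rcases lt_or_ge r (-1) with h' | h'
    · rw [z1 _ (by lia), z2 _ (Or.inl h'), z2 _ (Or.inl h')]; ring
    -- The shifts leave a row r = -1 outside the quadrant. There the shifted θ(9) terms cancel -D(N,
    -- 0), because 1 - q^{8(N+1)} = (1 - q^{4(N+1)})(1 + q^{4(N+1)}).
    obtain rfl : r = -1 := by lia
    rcases lt_or_ge N 0 with h'' | h''
    · obtain rfl : N = -1 := by lia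
      rw [z1 _ (by lia)]
      simp [quadTerm]
    · lift N to ℕ using h''
      have a1 := quadTerm_eq_pow hx0 (α := -8) (γ := 0) (invNeg x 0) (betaEven (x ^ 2))
        (N := N + 1) (r := -1 + 1) (m := 4 * N ^ 2 + 4 * N) (by push_cast; ring)
      have a2 := quadTerm_eq_pow hx0 (α := 8) (γ := 0) (invNeg x 0) (betaEven (x ^ 2))
        (N := N + 1) (r := -1 + 1) (m := 4 * (N + 1) ^ 2 + 4 * (N + 1)) (by push_cast; ring)
      have a3 := quadTerm_eq_pow hx0 (α := 8) (γ := 4) (invNeg x 1) (betaEven (x ^ 2))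
        (N := N) (r := -1 + 1) (m := 4 * N ^ 2 + 4 * N) (by push_cast; ring)
      have i0 : invNeg x 0 (N + 1) =
          (qPoch (-(x ^ 2) ^ 2) ((x ^ 2) ^ 2) (2 * N + 1 + 1))⁻¹ := by
        simpa [mul_add] using invNeg_natCast x 0 N 1
      have i1 : invNeg x 1 N = (qPoch (-(x ^ 2) ^ 2) ((x ^ 2) ^ 2) (2 * N + 1))⁻¹ := by
        simpa using invNeg_natCast x 1 N 0
      have i2 := qPoch_inv_eq_mul_succ (a := -(x ^ 2) ^ 2) (by rwa [norm_neg]) hQ (2 * N + 1)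
      have r1 := recipQPoch_eq_mul_succ hp N
      rw [← Nat.cast_add_one, zpow_natCast, Nat.cast_add_one] at r1
      rw [a1, a2, a3, i0, i1, i2, neg_add_cancel, sub_zero, sub_zero, r1]
      ring
  · obtain ⟨n, r⟩ := p
    have a1 := quadTerm_eq_pow hx0 (α := -8) (γ := 0) (invNeg x 0) (betaEven (x ^ 2))
      (N := n + r + 1) (r := r + 1) (m := 4 * (n + r) ^ 2 + 4 * (n + r) + 2 * (r + 1) ^ 2)
      (by push_cast; ring)
    have a2 := quadTerm_eq_pow hx0 (α := 8) (γ := 0) (invNeg x 0) (betaEven (x ^ 2))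
      (N := n + r + 1) (r := r + 1) (m := 4 * (n + r + 1) ^ 2 + 4 * (n + r + 1) + 2 * (r + 1) ^ 2)
      (by push_cast; ring)
    have a3 := quadTerm_eq_pow hx0 (α := 8) (γ := 4) (invNeg x 1) (betaEven (x ^ 2))
      (N := n + r) (r := r) (m := 4 * (n + r) ^ 2 + 4 * (n + r) + 2 * r ^ 2 + 2 * r)
      (by push_cast; ring)
    have a4 := quadTerm_eq_pow hx0 (α := 8) (γ := 4) (invNeg x 1) (betaEven (x ^ 2))
      (N := n + r) (r := r + 1)
      (m := 4 * (n + r) ^ 2 + 4 * (n + r) + 2 * (r + 1) ^ 2 + 2 * (r + 1)) (by push_cast; ring)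
    have i0 : invNeg x 0 (n + r + 1) =
        (qPoch (-(x ^ 2) ^ 2) ((x ^ 2) ^ 2) (2 * n + 2 * r + 1 + 1))⁻¹ := by
      simpa [add_assoc, mul_add] using invNeg_natCast x 0 n (r + 1)
    have i1 := invNeg_natCast x 1 n r
    have i2 := qPoch_inv_eq_mul_succ (a := -(x ^ 2) ^ 2) (by rwa [norm_neg]) hQ (2 * n + 2 * r + 1)
    have r1 : recipQPoch ((x ^ 2) ^ 4) ((n : ℤ) + r + 1 - (r + 1)) =
        (qPoch ((x ^ 2) ^ 4) ((x ^ 2) ^ 4) n)⁻¹ := by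
      rw [← recipQPoch_natCast]; congr 1; ring
    have r2 : recipQPoch ((x ^ 2) ^ 4) ((n : ℤ) + r - r) =
        (qPoch ((x ^ 2) ^ 4) ((x ^ 2) ^ 4) n)⁻¹ := by
      rw [← recipQPoch_natCast]; congr 1; ring
    have r3 : recipQPoch ((x ^ 2) ^ 4) ((n : ℤ) + r - (r + 1)) =
        (1 - ((x ^ 2) ^ 4) ^ n) * (qPoch ((x ^ 2) ^ 4) ((x ^ 2) ^ 4) n)⁻¹ := by
      rw [← recipQPoch_natCast_sub_one hp]; congr 1; ring
    have b1 := betaEven_natCast (x ^ 2) r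
    have b2 := betaEven_natCast (x ^ 2) (r + 1)
    have b3 := qPoch_inv_eq_mul_succ (a := -x ^ 2) (by rwa [norm_neg]) hq (2 * r)
    have b4 := qPoch_inv_eq_mul_succ (a := -x ^ 2) (by rwa [norm_neg]) hq (2 * r + 1)
    have b5 := qPoch_inv_eq_mul_succ hQ hQ r
    rw [show 2 * (r + 1) = 2 * r + 1 + 1 by ring] at b2
    push_cast at i1 b2
    simp only [add_zero]
    rw [a1, a2, a3, a4, i0, i1, r1, r2, r3, b1, b2, b3, b4, b5, i2]
    rw [div_eq_mul_inv, mul_inv, mul_inv, mul_inv, i2, b5]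
    ring

/-- To the series for θ(7) is added G(N, r+1) - G(N, r), of total 0, where G contains q^{-2} and
`betaOdd` at r - 1. Since G vanishes for r ≤ 0, no boundary row appears. -/
theorem hasSum_fourth :
    HasSum (fun p : ℕ × ℕ => let n := p.1; let r := p.2
        (x ^ 2) ^ (4 * (n : ℤ) ^ 2 + 8 * (n : ℤ) * (r : ℤ) + 6 * (r : ℤ) ^ 2 - 2) *
            ((x ^ 2) ^ (4 * r) + (x ^ 2) ^ (4 * r + 2) + (x ^ 2) ^ (6 * r + 1) +
              (x ^ 2) ^ (4 * n + 6 * r + 3) - 1 - (x ^ 2) ^ (2 * r + 1)) /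
          (qPoch (-(x ^ 2) ^ 2) ((x ^ 2) ^ 2) (2 * n + 2 * r) *
            qPoch ((x ^ 2) ^ 2) ((x ^ 2) ^ 2) r *
            qPoch (-x ^ 2) (x ^ 2) (2 * r + 1) * qPoch ((x ^ 2) ^ 4) ((x ^ 2) ^ 4) n))
      (theta15 x 7 * invEta x) := by
  have hq0 : x ^ 2 ≠ 0 := pow_ne_zero 2 hx0
  have hq := norm_pow_lt_one hx two_ne_zero
  have hQ := norm_pow_lt_one hq two_ne_zero
  have hp := norm_pow_lt_one hq four_ne_zero
  have hG := (summable_quadTerm hx0 hx 0 0 0 (β := fun r => betaOdd (x ^ 2) (r - 1)) (by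
    obtain ⟨C, hC⟩ := exists_norm_betaOdd_le hx
    exact ⟨C, fun r => hC _⟩)).hasSum.mul_left ((x ^ 2) ^ 2)⁻¹
  have hF := (hasSum_quadTerm_seven hx0 hx).add ((hG.int_prod_add 0 1).sub hG)
  rw [sub_self, add_zero] at hF
  refine (hF.nat_of_int fun N r hr => ?_).of_eq (fun p => ?_) rfl
  · have z1 : quadTerm x 8 0 (invNeg x 0) (betaEven (x ^ 2)) (N, r) = 0 :=
      quadTerm_eq_zero x _ _ _ (hr.imp_left (betaEven_of_neg _))
    have z2 : ∀ s, s ≤ 0 ∨ N < s →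
        quadTerm x 0 0 (invNeg x 0) (fun r => betaOdd (x ^ 2) (r - 1)) (N, s) = 0 := fun s hs =>
      quadTerm_eq_zero x _ _ _ (hs.imp_left fun h => betaOdd_of_neg _ (by lia))
    simp only [add_zero]
    rw [z1, z2 r (by lia), z2 (r + 1) (by lia)]
    ring
  · obtain ⟨n, r⟩ := p
    have a1 := quadTerm_eq_pow hx0 (α := 8) (γ := 0) (invNeg x 0) (betaEven (x ^ 2))
      (N := n + r) (r := r) (m := 4 * (n + r) ^ 2 + 4 * (n + r) + 2 * r ^ 2) (by push_cast; ring)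
    have a2 := quadTerm_eq_pow hx0 (α := 0) (γ := 0) (invNeg x 0)
      (fun r => betaOdd (x ^ 2) (r - 1)) (N := n + r) (r := r + 1)
      (m := 4 * (n + r) ^ 2 + 2 * (r + 1) ^ 2) (by push_cast; ring)
    have a3 := quadTerm_eq_pow hx0 (α := 0) (γ := 0) (invNeg x 0)
      (fun r => betaOdd (x ^ 2) (r - 1)) (N := n + r) (r := r)
      (m := 4 * (n + r) ^ 2 + 2 * r ^ 2) (by push_cast; ring)
    have i0 := invNeg_natCast x 0 n r
    have r2 : recipQPoch ((x ^ 2) ^ 4) ((n : ℤ) + r - r) =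
        (qPoch ((x ^ 2) ^ 4) ((x ^ 2) ^ 4) n)⁻¹ := by
      rw [← recipQPoch_natCast]; congr 1; ring
    have r3 : recipQPoch ((x ^ 2) ^ 4) ((n : ℤ) + r - (r + 1)) =
        (1 - ((x ^ 2) ^ 4) ^ n) * (qPoch ((x ^ 2) ^ 4) ((x ^ 2) ^ 4) n)⁻¹ := by
      rw [← recipQPoch_natCast_sub_one hp]; congr 1; ring
    have b1 := betaEven_eq hq0 hq r
    have b2 := betaOdd_sub_one hq0 hq r
    have b3 := betaOdd_natCast (x ^ 2) r
    have e1 : (x ^ 2) ^ (2 * (r : ℤ) + 1) = (x ^ 2) ^ (2 * r + 1) := by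
      rw [← zpow_natCast]; push_cast; rfl
    have e2 : (x ^ 2) ^ (4 * (r : ℤ)) = (x ^ 2) ^ (4 * r) := by
      rw [← zpow_natCast]; push_cast; rfl
    have e3 : (x ^ 2) ^ (4 * (n : ℤ) ^ 2 + 8 * (n : ℤ) * (r : ℤ) + 6 * (r : ℤ) ^ 2 - 2) =
        (x ^ 2) ^ (4 * n ^ 2 + 8 * n * r + 6 * r ^ 2) * ((x ^ 2) ^ 2)⁻¹ := by
      rw [zpow_sub₀ hq0, div_eq_mul_inv, ← zpow_natCast]; push_cast; rfl
    rw [e1] at b1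
    rw [e2] at b2
    push_cast at i0
    simp only [add_zero] at i0 ⊢
    rw [a1, a2, a3, i0, r2, r3, add_sub_cancel_right, b2, b1, b3, e3]
    rw [div_eq_mul_inv, mul_inv, mul_inv, mul_inv]
    field_simp
    ring

end

/-! ### The degenerate case q = 0 and the assembly -/

theorem qPoch_zero_zero (m : ℕ) : qPoch 0 0 m = 1 := by simp [qPoch]

theorem hasSum_nat_prod_single {f : ℕ × ℕ → ℂ} (h0 : f (0, 0) = 1)
    (h : ∀ n r, 0 < n ∨ 0 < r → f (n, r) = 0) : HasSum f 1 := by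
  rw [← h0]
  refine hasSum_single (0, 0) fun p hp => h p.1 p.2 ?_
  by_contra hc
  push Not at hc
  exact hp (Prod.ext (by lia) (by lia))

theorem mainTheorem7 (q : ℂ) (hq : ‖q‖ < 1) :
    HasSum (fun p : ℕ × ℕ => let n := p.1; let r := p.2
        q ^ (4 * n ^ 2 + 8 * n * r + 6 * r ^ 2 + 4 * n + 6 * r) /
          (qPoch (-q ^ 2) (q ^ 2) (2 * n + 2 * r + 1) * qPoch (q ^ 2) (q ^ 2) r *
            qPoch (-q) q (2 * r + 1) * qPoch (q ^ 4) (q ^ 4) n))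
      (qPochInf₃ q (q ^ 14) (q ^ 15) (q ^ 15) / qPochInf (q ^ 4) (q ^ 4)) ∧
    HasSum (fun p : ℕ × ℕ => let n := p.1; let r := p.2
        q ^ (4 * n ^ 2 + 8 * n * r + 6 * r ^ 2 + 4 * n + 6 * r) /
          (qPoch (-q ^ 2) (q ^ 2) (2 * n + 2 * r + 1) * qPoch (q ^ 2) (q ^ 2) r *
            qPoch (-q) q (2 * r) * qPoch (q ^ 4) (q ^ 4) n))
      (qPochInf₃ (q ^ 2) (q ^ 13) (q ^ 15) (q ^ 15) / qPochInf (q ^ 4) (q ^ 4)) ∧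
    HasSum (fun p : ℕ × ℕ => let n := p.1; let r := p.2
        q ^ (4 * n ^ 2 + 8 * n * r + 6 * r ^ 2 + 4 * n + 6 * r) *
            (1 + q ^ (2 * r + 1) + 2 * q ^ (2 * r + 2) + q ^ (4 * r + 3) +
              q ^ (4 * n + 4 * r + 4)) /
          (qPoch (-q ^ 2) (q ^ 2) (2 * n + 2 * r + 1) * qPoch (q ^ 2) (q ^ 2) r *
            qPoch (-q) q (2 * r + 2) * qPoch (q ^ 4) (q ^ 4) n))
      (qPochInf₃ (q ^ 3) (q ^ 12) (q ^ 15) (q ^ 15) / qPochInf (q ^ 4) (q ^ 4)) ∧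
    (q ≠ 0 →
      HasSum (fun p : ℕ × ℕ => let n := p.1; let r := p.2
          q ^ (4 * (n : ℤ) ^ 2 + 8 * (n : ℤ) * (r : ℤ) + 6 * (r : ℤ) ^ 2 - 2) *
              (q ^ (4 * r) + q ^ (4 * r + 2) + q ^ (6 * r + 1) + q ^ (4 * n + 6 * r + 3) -
                1 - q ^ (2 * r + 1)) /
            (qPoch (-q ^ 2) (q ^ 2) (2 * n + 2 * r) * qPoch (q ^ 2) (q ^ 2) r *
              qPoch (-q) q (2 * r + 1) * qPoch (q ^ 4) (q ^ 4) n))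
        (qPochInf₃ (q ^ 4) (q ^ 11) (q ^ 15) (q ^ 15) / qPochInf (q ^ 4) (q ^ 4))) ∧
    HasSum (fun p : ℕ × ℕ => let n := p.1; let r := p.2
        q ^ (4 * n ^ 2 + 8 * n * r + 6 * r ^ 2 + 2 * r) * (1 + q ^ (4 * n + 2 * r + 1)) /
          (qPoch (-q ^ 2) (q ^ 2) (2 * n + 2 * r) * qPoch (q ^ 2) (q ^ 2) r *
            qPoch (-q) q (2 * r + 1) * qPoch (q ^ 4) (q ^ 4) n))
      (qPochInf (q ^ 5) (q ^ 5) / qPochInf (q ^ 4) (q ^ 4)) ∧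
    HasSum (fun p : ℕ × ℕ => let n := p.1; let r := p.2
        q ^ (4 * n ^ 2 + 8 * n * r + 6 * r ^ 2 + 2 * r) /
          (qPoch (-q ^ 2) (q ^ 2) (2 * n + 2 * r) * qPoch (q ^ 2) (q ^ 2) r *
            qPoch (-q) q (2 * r) * qPoch (q ^ 4) (q ^ 4) n))
      (qPochInf₃ (q ^ 6) (q ^ 9) (q ^ 15) (q ^ 15) / qPochInf (q ^ 4) (q ^ 4)) ∧
    HasSum (fun p : ℕ × ℕ => let n := p.1; let r := p.2
        q ^ (4 * n ^ 2 + 8 * n * r + 6 * r ^ 2) /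
          (qPoch (-q ^ 2) (q ^ 2) (2 * n + 2 * r) * qPoch (q ^ 2) (q ^ 2) r *
            qPoch (-q) q (2 * r) * qPoch (q ^ 4) (q ^ 4) n))
      (qPochInf₃ (q ^ 7) (q ^ 8) (q ^ 15) (q ^ 15) / qPochInf (q ^ 4) (q ^ 4)) := by
  by_cases hq0 : q = 0
  · subst hq0
    have hR : ∀ a b c d e f : ℕ, a ≠ 0 → b ≠ 0 → c ≠ 0 → e ≠ 0 →
        qPochInf₃ ((0 : ℂ) ^ a) (0 ^ b) (0 ^ c) (0 ^ d) / qPochInf (0 ^ e) (0 ^ f) = 1 := by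
      intro a b c d e f ha hb hc he
      simp [qPochInf₃, qPochInf_zero_left, ha, hb, hc, he]
    refine ⟨?_, ?_, ?_, fun h => absurd rfl h, ?_, ?_, ?_⟩
    · rw [show qPochInf₃ (0 : ℂ) (0 ^ 14) (0 ^ 15) (0 ^ 15) / qPochInf (0 ^ 4) (0 ^ 4) = 1 by
        simp [qPochInf₃, qPochInf_zero_left]]
      refine hasSum_nat_prod_single (by simp [qPoch_zero_zero]) fun n r hnr => ?_
      have hE : 4 * n ^ 2 + 8 * n * r + 6 * r ^ 2 + 4 * n + 6 * r ≠ 0 := by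
        rcases hnr with h | h <;> positivity
      simp only [zero_pow hE, zero_div]
    · rw [hR _ _ _ _ _ _ (by norm_num) (by norm_num) (by norm_num) (by norm_num)]
      refine hasSum_nat_prod_single (by simp [qPoch_zero_zero]) fun n r hnr => ?_
      have hE : 4 * n ^ 2 + 8 * n * r + 6 * r ^ 2 + 4 * n + 6 * r ≠ 0 := by
        rcases hnr with h | h <;> positivity
      simp only [zero_pow hE, zero_div]
    · rw [hR _ _ _ _ _ _ (by norm_num) (by norm_num) (by norm_num) (by norm_num)]
      refine hasSum_nat_prod_single (by simp [qPoch_zero_zero]) fun n r hnr => ?_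
      have hE : 4 * n ^ 2 + 8 * n * r + 6 * r ^ 2 + 4 * n + 6 * r ≠ 0 := by
        rcases hnr with h | h <;> positivity
      simp only [zero_pow hE, zero_mul, zero_div]
    · rw [show qPochInf ((0 : ℂ) ^ 5) (0 ^ 5) / qPochInf (0 ^ 4) (0 ^ 4) = 1 by
        simp [qPochInf_zero_left]]
      refine hasSum_nat_prod_single (by simp [qPoch_zero_zero]) fun n r hnr => ?_
      have hE : 4 * n ^ 2 + 8 * n * r + 6 * r ^ 2 + 2 * r ≠ 0 := by
        rcases hnr with h | h <;> positivity
      simp only [zero_pow hE, zero_mul, zero_div]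
    · rw [hR _ _ _ _ _ _ (by norm_num) (by norm_num) (by norm_num) (by norm_num)]
      refine hasSum_nat_prod_single (by simp) fun n r hnr => ?_
      have hE : 4 * n ^ 2 + 8 * n * r + 6 * r ^ 2 + 2 * r ≠ 0 := by
        rcases hnr with h | h <;> positivity
      simp only [zero_pow hE, zero_div]
    · rw [hR _ _ _ _ _ _ (by norm_num) (by norm_num) (by norm_num) (by norm_num)]
      refine hasSum_nat_prod_single (by simp) fun n r hnr => ?_
      have hE : 4 * n ^ 2 + 8 * n * r + 6 * r ^ 2 ≠ 0 := by
        rcases hnr with h | h <;> positivity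
      simp only [zero_pow hE, zero_div]
  -- A square root of q makes the exponents (3j² + cj)/2 and (15j² + cj)/2 integral.
  · obtain ⟨x, rfl⟩ : ∃ x : ℂ, x ^ 2 = q := ⟨q ^ (1 / 2 : ℂ), by
      rw [← Complex.cpow_nat_mul]; norm_num⟩
    have hx0 : x ≠ 0 := fun h => hq0 (by simp [h])
    have hx : ‖x‖ < 1 := by
      rw [norm_pow] at hq
      exact lt_of_pow_lt_pow_left₀ 2 zero_le_one (by simpa using hq)
    have eta : invEta x = (qPochInf ((x ^ 2) ^ 4) ((x ^ 2) ^ 4))⁻¹ := by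
      rw [invEta, show (x ^ 4) ^ 2 = (x ^ 2) ^ 4 by ring]
    have c1 := theta15_eq_qPochInf₃ hx0 hx 1 14 (c := 13) rfl (by norm_num)
    have c2 := theta15_eq_qPochInf₃ hx0 hx 2 13 (c := 11) rfl (by norm_num)
    have c3 := theta15_eq_qPochInf₃ hx0 hx 3 12 (c := 9) rfl (by norm_num)
    have c4 := theta15_eq_qPochInf₃ hx0 hx 4 11 (c := 7) rfl (by norm_num)
    have c5 := theta15_eq_qPochInf₃ hx0 hx 5 10 (c := 5) rfl (by norm_num)
    have c6 := theta15_eq_qPochInf₃ hx0 hx 6 9 (c := 3) rfl (by norm_num)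
    have c7 := theta15_eq_qPochInf₃ hx0 hx 7 8 (c := 1) rfl (by norm_num)
    -- The fifth product (q⁵,q¹⁰,q¹⁵;q¹⁵)_∞ is (q⁵;q⁵)_∞ split by residues modulo 3.
    have c5' := qPochInf_eq_mul_three ((x ^ 2) ^ 5) (norm_pow_lt_one hq (by norm_num : 5 ≠ 0))
    rw [show (x ^ 2) ^ 5 * (x ^ 2) ^ 5 = (x ^ 2) ^ 10 by ring,
      show ((x ^ 2) ^ 5) ^ 2 * (x ^ 2) ^ 5 = (x ^ 2) ^ 15 by ring,
      show ((x ^ 2) ^ 5) ^ 3 = (x ^ 2) ^ 15 by ring] at c5'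
    rw [pow_one] at c1
    have r2 : ∀ n r : ℕ, recipQPoch ((x ^ 2) ^ 4) ((n : ℤ) + r - r) =
        (qPoch ((x ^ 2) ^ 4) ((x ^ 2) ^ 4) n)⁻¹ := fun n r => by
      rw [← recipQPoch_natCast]; congr 1; ring
    have i0 := fun n r => invNeg_natCast x 0 n r
    have i1 := fun n r => invNeg_natCast x 1 n r
    simp only [Nat.cast_zero, Nat.cast_one, add_zero] at i0 i1
    have v : ∀ (α γ i : ℤ) {β : ℤ → ℂ}, (∀ r, r < 0 → β r = 0) → ∀ N r : ℤ, r < 0 ∨ N < r →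
        quadTerm x α γ (invNeg x i) β (N, r) = 0 := fun α γ i β hβ N r h =>
      quadTerm_eq_zero x _ _ _ (h.imp_left (hβ r))
    have vE : ∀ r, r < 0 → betaEven (x ^ 2) r = 0 := fun r h => betaEven_of_neg _ h
    have vO : ∀ r, r < 0 → betaOdd (x ^ 2) r = 0 := fun r h => betaOdd_of_neg _ h
    refine ⟨?_, ?_, ?_, fun _ => ?_, ?_, ?_, ?_⟩
    · refine ((hasSum_quadTerm_thirteen hx0 hx).nat_of_int (v _ _ _ vO)).of_eq (fun p => ?_)
        (by rw [c1, eta, div_eq_mul_inv])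
      obtain ⟨n, r⟩ := p
      have a := quadTerm_eq_pow hx0 (α := 8) (γ := 4) (invNeg x 1) (betaOdd (x ^ 2))
        (N := n + r) (r := r) (m := 4 * n ^ 2 + 8 * n * r + 6 * r ^ 2 + 4 * n + 6 * r)
        (by push_cast; ring)
      simp only []
      rw [a, i1, r2, betaOdd_natCast, div_eq_mul_inv, mul_inv, mul_inv, mul_inv]
      ring
    · refine ((hasSum_quadTerm_eleven hx0 hx).nat_of_int (v _ _ _ vE)).of_eq (fun p => ?_)
        (by rw [c2, eta, div_eq_mul_inv])
      obtain ⟨n, r⟩ := p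
      have a := quadTerm_eq_pow hx0 (α := 8) (γ := 4) (invNeg x 1) (betaEven (x ^ 2))
        (N := n + r) (r := r) (m := 4 * n ^ 2 + 8 * n * r + 6 * r ^ 2 + 4 * n + 6 * r)
        (by push_cast; ring)
      simp only []
      rw [a, i1, r2, betaEven_natCast, div_eq_mul_inv, mul_inv, mul_inv, mul_inv]
      ring
    · exact (hasSum_third hx0 hx).of_eq (fun _ => rfl) (by rw [c3, eta, div_eq_mul_inv])
    · exact (hasSum_fourth hx0 hx).of_eq (fun _ => rfl) (by rw [c4, eta, div_eq_mul_inv])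
    · refine ((hasSum_quadTerm_five hx0 hx).nat_of_int fun N r h => by
        rw [v _ _ _ vO N r h, v _ _ _ vO N r h, mul_zero, add_zero]).of_eq (fun p => ?_)
        (by rw [c5, c5', eta, div_eq_mul_inv])
      obtain ⟨n, r⟩ := p
      have a := quadTerm_eq_pow hx0 (α := 0) (γ := 4) (invNeg x 0) (betaOdd (x ^ 2))
        (N := n + r) (r := r) (m := 4 * n ^ 2 + 8 * n * r + 6 * r ^ 2 + 2 * r)
        (by push_cast; ring)
      have b := quadTerm_eq_pow hx0 (α := 8) (γ := 0) (invNeg x 0) (betaOdd (x ^ 2))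
        (N := n + r) (r := r) (m := 4 * n ^ 2 + 8 * n * r + 6 * r ^ 2 + 4 * n + 4 * r)
        (by push_cast; ring)
      simp only []
      rw [a, b, i0, r2, betaOdd_natCast, div_eq_mul_inv, mul_inv, mul_inv, mul_inv]
      ring
    · refine ((hasSum_quadTerm_three hx0 hx).nat_of_int (v _ _ _ vE)).of_eq (fun p => ?_)
        (by rw [c6, eta, div_eq_mul_inv])
      obtain ⟨n, r⟩ := p
      have a := quadTerm_eq_pow hx0 (α := 0) (γ := 4) (invNeg x 0) (betaEven (x ^ 2))
        (N := n + r) (r := r) (m := 4 * n ^ 2 + 8 * n * r + 6 * r ^ 2 + 2 * r)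
        (by push_cast; ring)
      simp only []
      rw [a, i0, r2, betaEven_natCast, div_eq_mul_inv, mul_inv, mul_inv, mul_inv]
      ring
    · refine ((hasSum_quadTerm_one hx0 hx).nat_of_int (v _ _ _ vE)).of_eq (fun p => ?_)
        (by rw [c7, eta, div_eq_mul_inv])
      obtain ⟨n, r⟩ := p
      have a := quadTerm_eq_pow hx0 (α := 0) (γ := 0) (invNeg x 0) (betaEven (x ^ 2))
        (N := n + r) (r := r) (m := 4 * n ^ 2 + 8 * n * r + 6 * r ^ 2)
        (by push_cast; ring)
      simp only []
      rw [a, i0, r2, betaEven_natCast, div_eq_mul_inv, mul_inv, mul_inv, mul_inv]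
      ring
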